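/- Let $X,Y,Z$ be real Hilbert spaces, $F:X\to(-\infty,+\infty]$ and $G:Y\to(-\infty,+\infty]$ proper, convex and lower semicontinuous, $A:X\to Z$ and $B:Y\to Z$ bounded linear, $c\in Z$, $r>0$. Consider the problem $$\min_{u\in X,\,p\in Y} F(u)+G(p)\quad\text{subject to}\quad Au+Bp=c, \tag{P}$$ and its Lagrangian $\mathcal L(u,p,\lambda)=F(u)+G(p)+\langle \lambda,Au+Bp-c\rangle$. For $x=(u,p,\lambda)$ and $x'=(u',p',\lambda')$ let $\mathfrak G_x(x')=\mathcal L(u',p',\lambda)-\mathcal L(u,p,\lambda')$ be the partial primal-dual gap. A point $(u^*,p^*,\lambda^*)$ is a saddle point of $\mathcal L$ if $\mathcal L(u^*,p^*,\lambda)\le\mathcal L(u^*,p^*,\lambda^*)\le\mathcal L(u,p,\lambda^*)$ for all $u,p,\lambda$. Assume that $rA^*A+\partial F$ and $rB^*B+\partial G$ are strongly maximal monotone (maximal monotone, and strongly monotone with some modulus $m>0$), that $N$ and $M$ are bounded self-adjoint operators on $X$ and $Y$ with $N-rA^*A\ge 0$ and $M-rB^*B\ge 0$, that $\rho_k\in(0,2)$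 $(k\ge 0)$ is non-decreasing with $\lim_k\rho_k<2$, and that $\mathcal L$ has a saddle point (so that, in particular, (P) has a solution). Let $(u^k,p^k,\lambda^k)_{k\ge0}$, with arbitrary $(u^0,p^0,\lambda^0)\in X\times Y\times Z$, satisfy for all $k\ge 0$ $$\begin{aligned} u^{k+1}&=(N+\partial F)^{-1}\bigl[A^*(-rBp^k+rc-\lambda^k)+(N-rA^*A)u^k\bigr],\\ p^{k+1}&=(M+\partial G)^{-1}\bigl[B^*(-r\rho_kAu^{k+1}+r(1-\rho_k)Bp^k-\lambda^k+r\rho_kc)+(M-rB^*B)p^k\bigr],\\ \lambda^{k+1}&=\lambda^k+r\bigl(\rho_kAu^{k+1}+Bp^{k+1}-(1-\rho_k)Bp^k-\rho_kc\bigr). \end{aligned}$$ For $k\ge 1$ define the ergodic averages $$u_{\rm erg}^k=\frac1k\sum_{j=2}^{k+1}u^j,\qquad p_{\rm erg}^k=\frac1k\sum_{j=2}^{k+1}p^j,\qquad \lambda_{\rm erg}^k=\frac1k\sum_{j=2}^{k+1}\lambda^j,$$ and $x_{\rm erg}^k=(u_{\rm erg}^k,p_{\rm erg}^k,\lambda_{\rm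 erg}^k)$. Then there is a saddle point $x^*=(u^*,p^*,\lambda^*)$ of $\mathcal L$, with $(u^*,p^*)$ a solution of (P), such that $u^k\rightharpoonup u^*$, $p^k\rightharpoonup p^*$, $\lambda^k\rightharpoonup\lambda^*$ and $u^k_{\rm erg}\rightharpoonup u^*$, $p^k_{\rm erg}\rightharpoonup p^*$, $\lambda^k_{\rm erg}\rightharpoonup\lambda^*$ weakly. Moreover $\mathfrak G_{x^*}(x^k_{\rm erg})\ge 0$ for all $k\ge 1$, and $\mathfrak G_{x^*}(x^k_{\rm erg})=\mathcal O(1/k)$. More precisely, let $S$ and $H$ be bounded linear operators on $X$ and $Y$ with $N-rA^*A=rS^*S$ and $M-rB^*B=rH^*H$ (for example the positive square roots of $(N-rA^*A)/r$ and $(M-rB^*B)/r$), and put $v^1=-rBp^1+\lambda^1$, $v^*=-rBp^*+\lambda^*$. If $\rho_1<1$ (in particular if $0<\rho_k<1$ for all $k$), then for all $k\ge1$ $$\begin{aligned}\mathfrak G_{x^*}(x_{\rm erg}^k)\le\frac1k\Bigl[&\frac{r\|Bp^1-Bp^*\|^2}{2}+\frac{\|\lambda^1-\lambda^*\|^2}{2r}+\frac{1-\rho_1}{2\rho_1r}\|v^1-v^*\|^2+\frac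 r2\|S(u^1-u^*)\|^2\\&+r\Bigl(\frac1{\rho_1}-\frac12\Bigr)\|H(p^1-p^0)\|^2+\frac r2\|H(p^1-p^*)\|^2\Bigr].\end{aligned}$$ If $\rho_1\ge1$ (in particular if $1\le\rho_k<2$ for all $k$), then for all $k\ge1$ $$\begin{aligned}\mathfrak G_{x^*}(x_{\rm erg}^k)\le\frac1k\Bigl[&\frac1{\rho_1}\Bigl(\frac{r\|Bp^1-Bp^*\|^2}{2}+\frac{\|\lambda^1-\lambda^*\|^2}{2r}+\frac{\rho_1-1}{2}\Bigl\|\sqrt r\,B(p^1-p^*)+\frac{\lambda^1-\lambda^*}{\sqrt r}\Bigr\|^2\Bigr)\\&+\frac r2\|S(u^1-u^*)\|^2+r\Bigl(\frac1{\rho_1}-\frac12\Bigr)\|H(p^1-p^0)\|^2+\frac r2\|H(p^1-p^*)\|^2\Bigr].\end{aligned}$$ -/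

import Mathlib

open Filter Topology

noncomputable section

namespace RelaxedADMM

/-! ### Convex functions and set-valued operators on a real Hilbert space -/

section Operators

variable {E : Type*} [NormedAddCommGroup E] [InnerProductSpace ℝ E]

/-- The class `Γ₀(E)`: proper, convex and lower semicontinuous functions with values in
`(-∞, +∞]`. -/
structure IsGammaZero (F : E → EReal) : Prop where
  ne_bot : ∀ x, F x ≠ ⊥
  exists_ne_top : ∃ x, F x ≠ ⊤
  convex : ∀ (x y : E) (a b : ℝ), 0 < a → 0 < b → a + b = 1 →
    F (a • x + b • y) ≤ (a : EReal) * F x + (b : EReal) * F y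
  lsc : LowerSemicontinuous F

/-- The convex subdifferential `∂F(x)`. (If `F` is proper and `F x = ⊤`, it is empty.) -/
def subdiff (F : E → EReal) (x : E) : Set E :=
  {ξ | ∀ y, F x + ((inner ℝ ξ (y - x) : ℝ) : EReal) ≤ F y}

/-- The set-valued operator `L + T`, with `L` bounded linear: `y ∈ (L + T) x` if and only if
`y = L x + ξ` for some `ξ ∈ T x`. -/
def addOp (L : E →L[ℝ] E) (T : E → Set E) (x : E) : Set E :=
  {y | ∃ ξ ∈ T x, y = L x + ξ}

/-- The inverse of a set-valued operator. -/
def invOp (T : E → Set E) (y : E) : Set E :=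
  {x | y ∈ T x}

/-- Monotonicity of a set-valued operator. -/
def IsMonotone (T : E → Set E) : Prop :=
  ∀ x y, ∀ ξ ∈ T x, ∀ η ∈ T y, 0 ≤ inner ℝ (ξ - η) (x - y)

/-- Maximal monotonicity: no monotone operator has a strictly larger graph. -/
def IsMaximalMonotone (T : E → Set E) : Prop :=
  IsMonotone T ∧ ∀ T' : E → Set E, IsMonotone T' → (∀ x, T x ⊆ T' x) → T' = T

/-- Strong monotonicity with some modulus `m > 0`. -/
def IsStronglyMonotone (T : E → Set E) : Prop :=
  ∃ m : ℝ, 0 < m ∧ ∀ x y, ∀ ξ ∈ T x, ∀ η ∈ T y,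
    m * ‖x - y‖ ^ 2 ≤ inner ℝ (ξ - η) (x - y)

/-- Strongly maximal monotone operators. -/
def IsStronglyMaximalMonotone (T : E → Set E) : Prop :=
  IsStronglyMonotone T ∧ IsMaximalMonotone T

/-- Weak convergence of a sequence. -/
def WeaklyConverges (x : ℕ → E) (a : E) : Prop :=
  Tendsto (fun k => toWeakSpace ℝ E (x k)) atTop (𝓝 (toWeakSpace ℝ E a))

/-- The ergodic averages `(1/k) * ∑_{j = 2}^{k+1} x^j` (meaningful for `k ≥ 1`). -/
def ergodic (x : ℕ → E) (k : ℕ) : E :=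
  (1 / (k : ℝ)) • ∑ j ∈ Finset.Icc 2 (k + 1), x j

end Operators

/-! ### The constrained problem, its Lagrangian, and the iteration -/

section Problem

variable {X Y Z : Type*}
  [NormedAddCommGroup X] [InnerProductSpace ℝ X]
  [NormedAddCommGroup Y] [InnerProductSpace ℝ Y]
  [NormedAddCommGroup Z] [InnerProductSpace ℝ Z]

/-- `(us, ps)` solves `min F u + G p` subject to `A u + B p = c`. -/
def IsSolution (F : X → EReal) (G : Y → EReal) (A : X →L[ℝ] Z) (B : Y →L[ℝ] Z) (c : Z)
    (us : X) (ps : Y) : Prop :=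
  A us + B ps = c ∧ ∀ u p, A u + B p = c → F us + G ps ≤ F u + G p

/-- The Lagrangian `F u + G p + ⟪l, A u + B p - c⟫`. -/
def lagrangian (F : X → EReal) (G : Y → EReal) (A : X →L[ℝ] Z) (B : Y →L[ℝ] Z) (c : Z)
    (u : X) (p : Y) (l : Z) : EReal :=
  F u + G p + ((inner ℝ l (A u + B p - c) : ℝ) : EReal)

/-- `(us, ps, ls)` is a saddle point of the Lagrangian (minimal in the first two variables,
maximal in the multiplier). -/
def IsSaddlePoint (F : X → EReal) (G : Y → EReal) (A : X →L[ℝ] Z) (B : Y →L[ℝ] Z) (c : Z)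
    (us : X) (ps : Y) (ls : Z) : Prop :=
  (∀ l, lagrangian F G A B c us ps l ≤ lagrangian F G A B c us ps ls) ∧
  (∀ u p, lagrangian F G A B c us ps ls ≤ lagrangian F G A B c u p ls)

/-- The partial primal-dual gap of the point `(u', p', l')` with respect to `(u, p, l)`. -/
def partialGap (F : X → EReal) (G : Y → EReal) (A : X →L[ℝ] Z) (B : Y →L[ℝ] Z) (c : Z)
    (u : X) (p : Y) (l : Z) (u' : X) (p' : Y) (l' : Z) : EReal :=
  lagrangian F G A B c u' p' l - lagrangian F G A B c u p l'

/-- The sequence `(u k, p k, l k)` is generated by the fully preconditioned relaxed ADMM, with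
arbitrary starting point `(u 0, p 0, l 0)`. -/
structure IsRpFADMM [CompleteSpace X] [CompleteSpace Y] [CompleteSpace Z]
    (F : X → EReal) (G : Y → EReal) (A : X →L[ℝ] Z) (B : Y →L[ℝ] Z) (c : Z)
    (r : ℝ) (ρ : ℕ → ℝ) (N : X →L[ℝ] X) (M : Y →L[ℝ] Y)
    (u : ℕ → X) (p : ℕ → Y) (l : ℕ → Z) : Prop where
  step_u : ∀ k, u (k + 1) ∈ invOp (addOp N (subdiff F))
    (A.adjoint (-(r • B (p k)) + r • c - l k) + (N - r • (A.adjoint ∘L A)) (u k))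
  step_p : ∀ k, p (k + 1) ∈ invOp (addOp M (subdiff G))
    (B.adjoint (-((r * ρ k) • A (u (k + 1))) + (r * (1 - ρ k)) • B (p k) - l k + (r * ρ k) • c)
      + (M - r • (B.adjoint ∘L B)) (p k))
  step_l : ∀ k, l (k + 1) = l k +
    r • (ρ k • A (u (k + 1)) + B (p (k + 1)) - (1 - ρ k) • B (p k) - ρ k • c)

end Problem

end RelaxedADMM

end

/-!
The proof is a Lyapunov argument that yields the ergodic rate and the weak convergence together.

With `P = N - r A*A` and `Q = M - r B*B`, unfolding the two resolvents gives
`-A*(l k + r e k) - P (u (k+1) - u k) ∈ ∂F (u (k+1))` and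
`-B* l (k+1) - Q (p (k+1) - p k) ∈ ∂G (p (k+1))`, where `e k = A u (k+1) + B p k - c` is the
residual (`IsRpFADMM.isRelaxedRun`). Pair these inclusions with a saddle point and write `z`, `b`
for the displacements of `l` and `B p`. The multiplier terms then balance exactly (`energy_step`)
in the quadratic form `‖z - r b‖² / (2 r ρ) + ⟪z, b⟫`, which is positive definite for `0 < ρ < 2`
and antitone in `ρ`. Hence `V k = ‖z - r b‖² / (2 r ρ k) + ⟪z, b⟫ + ⟪P x, x⟫ / 2 + ⟪Q y, y⟫ / 2`,
with `x`, `y` the displacements of `u`, `p`, decreases by at least the gap at the new iterate plus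
a positive multiple of `‖e k‖²` plus half the semi-norms of the two increments
(`IsRelaxedRun.descent`). Summing from `k = 1` and applying Jensen's inequality bounds the gap at
the ergodic averages by `V 1 / k` (`IsRelaxedRun.partialGap_ergodic_le`); the explicit constants
are upper bounds for `V 1`.

For the convergence, `V` bounds `l` and `B p`, and strong monotonicity of `r A*A + ∂F` and
`r B*B + ∂G` then bounds `u` and `p`. The residuals and the semi-norms of the increments tend to
zero, and so do the increments of `B p`, by monotonicity of `∂G` at consecutive iterates. Therefore
every weak limit along an ultrafilter is a saddle point
(`IsRelaxedRun.isSaddlePoint_of_weakTendsto`). Since `V` converges for each saddle point, also with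
`ρ k` replaced by its limit, Opial's argument shows that `V` vanishes on the difference of two such
weak limits (`IsRelaxedRun.lyapunov_limit_sub`); by strong monotonicity they are equal
(`IsRelaxedRun.eq_of_lyapunov_eq_zero`). Using ultrafilters replaces the extraction of weakly
convergent subsequences.
-/

namespace RelaxedADMM

/-! ### Convex functions, subgradients and weak limits -/

section ConvexAnalysis

variable {E : Type*} [NormedAddCommGroup E] [InnerProductSpace ℝ E]

theorem IsGammaZero.coe_toReal {F : E → EReal} (hF : IsGammaZero F) {x : E} (hx : F x ≠ ⊤) :
    ((F x).toReal : EReal) = F x :=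
  EReal.coe_toReal hx (hF.ne_bot x)

theorem IsGammaZero.ne_top_of_mem_subdiff {F : E → EReal} (hF : IsGammaZero F) {x ξ : E}
    (hξ : ξ ∈ subdiff F x) : F x ≠ ⊤ := by
  intro hx
  obtain ⟨y, hy⟩ := hF.exists_ne_top
  have h := hξ y
  rw [hx, EReal.top_add_coe] at h
  exact hy (top_le_iff.mp h)

theorem IsGammaZero.add_inner_le {F : E → EReal} (hF : IsGammaZero F) {x ξ y : E}
    (hξ : ξ ∈ subdiff F x) (hy : F y ≠ ⊤) :
    (F x).toReal + inner ℝ ξ (y - x) ≤ (F y).toReal := by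
  have h := hξ y
  rw [← hF.coe_toReal hy, ← hF.coe_toReal (hF.ne_top_of_mem_subdiff hξ)] at h
  exact_mod_cast h

theorem IsGammaZero.subdiff_monotone {F : E → EReal} (hF : IsGammaZero F) :
    IsMonotone (subdiff F) := by
  intro x y ξ hξ η hη
  have h1 := hF.add_inner_le hξ (hF.ne_top_of_mem_subdiff hη)
  have h2 := hF.add_inner_le hη (hF.ne_top_of_mem_subdiff hξ)
  simp only [inner_sub_left, inner_sub_right] at h1 h2 ⊢
  linarith

theorem IsGammaZero.map_le {F : E → EReal} (hF : IsGammaZero F) {x y : E} {a b s t : ℝ}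
    (ha : 0 < a) (hb : 0 < b) (hab : a + b = 1) (hx : F x ≤ s) (hy : F y ≤ t) :
    F (a • x + b • y) ≤ ((a * s + b * t : ℝ) : EReal) := by
  refine (hF.convex x y a b ha hb hab).trans ?_
  rw [EReal.coe_add, EReal.coe_mul, EReal.coe_mul]
  gcongr

theorem IsGammaZero.convexOn_toReal {F : E → EReal} (hF : IsGammaZero F) :
    ConvexOn ℝ {x | F x ≠ ⊤} (fun x => (F x).toReal) := by
  have key : ∀ {x y : E}, F x ≠ ⊤ → F y ≠ ⊤ → ∀ {a b : ℝ}, 0 < a → 0 < b → a + b = 1 →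
      F (a • x + b • y) ≤ ((a * (F x).toReal + b * (F y).toReal : ℝ) : EReal) :=
    fun {x y} hx hy {a b} ha hb hab =>
      hF.map_le ha hb hab (hF.coe_toReal hx).ge (hF.coe_toReal hy).ge
  refine convexOn_iff_forall_pos.mpr ⟨?_, ?_⟩
  · refine convex_iff_forall_pos.mpr fun x hx y hy a b ha hb hab => ?_
    exact ((key hx hy ha hb hab).trans_lt (EReal.coe_lt_top _)).ne
  · intro x hx y hy a b ha hb hab
    have h := key hx hy ha hb hab
    rw [← hF.coe_toReal (h.trans_lt (EReal.coe_lt_top _)).ne] at h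
    exact_mod_cast h

theorem IsGammaZero.convex_sublevel {F : E → EReal} (hF : IsGammaZero F) (t : ℝ) :
    Convex ℝ {x | F x ≤ t} := by
  refine convex_iff_forall_pos.mpr fun x hx y hy a b ha hb hab => ?_
  have h := hF.map_le ha hb hab hx hy
  rwa [← add_mul, hab, one_mul] at h

/-- Strong monotonicity of `L + T`, spelled out as an inequality for `T` alone. -/
theorem IsStronglyMonotone.exists_modulus {L : E →L[ℝ] E} {T : E → Set E}
    (h : IsStronglyMonotone (addOp L T)) :
    ∃ m : ℝ, 0 < m ∧ ∀ x y, ∀ ξ ∈ T x, ∀ η ∈ T y,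
      m * ‖x - y‖ ^ 2 ≤ inner ℝ (ξ - η) (x - y) + inner ℝ (L (x - y)) (x - y) := by
  obtain ⟨m, hm, h⟩ := h
  refine ⟨m, hm, fun x y ξ hξ η hη => (h x y _ ⟨ξ, hξ, rfl⟩ _ ⟨η, hη, rfl⟩).trans_eq ?_⟩
  rw [← inner_add_left, map_sub]
  congr 1
  abel

/-- Weak convergence along an arbitrary filter; `WeaklyConverges` is the case `atTop`. -/
def WeakTendsto {ι : Type*} (x : ι → E) (U : Filter ι) (a : E) : Prop :=
  Tendsto (fun k => toWeakSpace ℝ E (x k)) U (𝓝 (toWeakSpace ℝ E a))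

theorem weakTendsto_iff_inner [CompleteSpace E] {ι : Type*} {x : ι → E} {U : Filter ι} {a : E} :
    WeakTendsto x U a ↔ ∀ y, Tendsto (fun k => inner ℝ y (x k)) U (𝓝 (inner ℝ y a)) := by
  have h : WeakTendsto x U a ↔
      ∀ φ : StrongDual ℝ E, Tendsto (fun k => φ (x k)) U (𝓝 (φ a)) := by
    refine WeakBilin.tendsto_iff_forall_eval_tendsto (topDualPairing ℝ E).flip ?_
    intro y z hyz
    exact (SeparatingDual.eq_iff_forall_dual_eq (R := ℝ)).mpr fun g => LinearMap.congr_fun hyz g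
  rw [h]
  constructor
  · exact fun h y => h (InnerProductSpace.toDual ℝ E y)
  · intro h φ
    simpa only [InnerProductSpace.toDual_symm_apply] using
      h ((InnerProductSpace.toDual ℝ E).symm φ)

/-- By Mazur's theorem the closed convex sublevel sets of `F` are weakly closed, so `F` is weakly
lower semicontinuous. -/
theorem IsGammaZero.eventually_lt_of_weakTendsto {F : E → EReal} (hF : IsGammaZero F)
    {ι : Type*} {x : ι → E} {U : Filter ι} {a : E} (h : WeakTendsto x U a) {t : EReal}
    (ht : t < F a) : ∀ᶠ k in U, t < F (x k) := by
  obtain ⟨s, hts, hs⟩ := EReal.lt_iff_exists_real_btwn.mp ht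
  have hcl : IsClosed (toWeakSpace ℝ E '' {z | F z ≤ s}) := by
    have h1 := (hF.convex_sublevel s).toWeakSpace_closure ℝ
    have h2 : IsClosed {z | F z ≤ s} := hF.lsc.isClosed_preimage _
    rw [h2.closure_eq] at h1
    rw [h1]
    exact isClosed_closure
  have hmem : toWeakSpace ℝ E a ∈ (toWeakSpace ℝ E '' {z | F z ≤ s})ᶜ := by
    rintro ⟨z, hz, hza⟩
    rw [(toWeakSpace ℝ E).injective hza] at hz
    exact (not_le.mpr hs) hz
  filter_upwards [h.eventually (hcl.isOpen_compl.mem_nhds hmem)] with k hk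
  refine hts.trans (not_le.mp fun hle => hk ⟨x k, hle, rfl⟩)

/-- Bounded families in a Hilbert space have weak limits along every ultrafilter. -/
theorem exists_weakTendsto_of_bounded [CompleteSpace E] {ι : Type*} {x : ι → E} {C : ℝ}
    (hC : ∀ k, ‖x k‖ ≤ C) (U : Ultrafilter ι) : ∃ a, WeakTendsto x U a := by
  let w : ι → WeakDual ℝ E := fun k => StrongDual.toWeakDual (InnerProductSpace.toDual ℝ E (x k))
  have hK := WeakDual.isCompact_closedBall (𝕜 := ℝ) (E := E) 0 C
  obtain ⟨φ, -, hφ⟩ := hK.ultrafilter_le_nhds (U.map w) (by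
    refine le_principal_iff.mpr (mem_map.mpr (Eventually.of_forall fun k => ?_))
    simp [w, hC k])
  have hφ' : Tendsto w U (𝓝 φ) := hφ
  refine ⟨(InnerProductSpace.toDual ℝ E).symm (WeakDual.toStrongDual φ),
    weakTendsto_iff_inner.mpr fun y => ?_⟩
  have h1 := (WeakDual.eval_continuous (𝕜 := ℝ) y).continuousAt.tendsto.comp hφ'
  rw [real_inner_comm, InnerProductSpace.toDual_symm_apply]
  refine h1.congr fun k => ?_
  simp [w, real_inner_comm]

theorem WeakTendsto.map [CompleteSpace E] {E' : Type*} [NormedAddCommGroup E']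
    [InnerProductSpace ℝ E'] [CompleteSpace E'] {ι : Type*} {x : ι → E} {U : Filter ι} {a : E}
    (h : WeakTendsto x U a) (T : E →L[ℝ] E') : WeakTendsto (fun k => T (x k)) U (T a) := by
  rw [weakTendsto_iff_inner] at h ⊢
  intro y
  simpa only [ContinuousLinearMap.adjoint_inner_left] using h (T.adjoint y)

theorem tendsto_inner_zero_of_bounded {ι : Type*} {U : Filter ι} {x y : ι → E} {C : ℝ}
    (hx : Tendsto x U (𝓝 0)) (hy : ∀ k, ‖y k‖ ≤ C) :
    Tendsto (fun k => inner ℝ (x k) (y k)) U (𝓝 0) := by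
  refine squeeze_zero_norm (fun k => ?_) (by simpa using hx.norm.mul_const C)
  exact (norm_inner_le_norm _ _).trans (mul_le_mul_of_nonneg_left (hy k) (norm_nonneg _))

theorem ergodic_eq_sum_range (x : ℕ → E) (k : ℕ) :
    ergodic x k = (1 / (k : ℝ)) • ∑ j ∈ Finset.range k, x (j + 2) := by
  rw [ergodic, Finset.range_eq_Ico, Finset.sum_Ico_add' x 0 k 2]
  rfl

theorem map_ergodic {E' : Type*} [NormedAddCommGroup E'] [InnerProductSpace ℝ E']
    (T : E →L[ℝ] E') (x : ℕ → E) (k : ℕ) :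
    T (ergodic x k) = (1 / (k : ℝ)) • ∑ j ∈ Finset.range k, T (x (j + 2)) := by
  rw [ergodic_eq_sum_range, map_smul, map_sum]

/-- Weak convergence is inherited by the ergodic averages (Cesàro). -/
theorem WeaklyConverges.ergodic [CompleteSpace E] {x : ℕ → E} {a : E} (h : WeaklyConverges x a) :
    WeaklyConverges (ergodic x) a := by
  refine weakTendsto_iff_inner.mpr fun y => ?_
  have h1 : Tendsto (fun k => inner ℝ y (x (k + 2))) atTop (𝓝 (inner ℝ y a)) :=
    (weakTendsto_iff_inner.mp h y).comp (tendsto_add_atTop_nat 2)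
  refine h1.cesaro.congr fun k => ?_
  rw [ergodic_eq_sum_range, inner_smul_right, inner_sum, one_div]

/-- Jensen's inequality for the ergodic averages, which involve only iterates of positive index,
where `F` is finite. -/
theorem IsGammaZero.map_ergodic_le {F : E → EReal} (hF : IsGammaZero F) {x : ℕ → E}
    (hx : ∀ j, F (x (j + 1)) ≠ ⊤) {k : ℕ} (hk : 1 ≤ k) :
    F (ergodic x k) ≠ ⊤ ∧
      (F (ergodic x k)).toReal ≤ 1 / (k : ℝ) * ∑ j ∈ Finset.range k, (F (x (j + 2))).toReal := by
  have hk0 : (k : ℝ) ≠ 0 := by positivity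
  have he : ergodic x k = ∑ j ∈ Finset.range k, (1 / (k : ℝ)) • x (j + 2) := by
    rw [ergodic_eq_sum_range, Finset.smul_sum]
  have h0 : ∀ i ∈ Finset.range k, (0 : ℝ) ≤ (fun _ => 1 / (k : ℝ)) i := fun i _ => by positivity
  have h1 : ∑ i ∈ Finset.range k, (fun _ => 1 / (k : ℝ)) i = 1 := by simp [hk0]
  rw [he]
  refine ⟨hF.convexOn_toReal.1.sum_mem h0 h1 fun i _ => hx (i + 1), ?_⟩
  rw [Finset.mul_sum]
  exact hF.convexOn_toReal.map_sum_le h0 h1 fun i _ => hx (i + 1)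

end ConvexAnalysis

/-! ### Positive operators -/

section PositiveOperators

variable {E : Type*} [NormedAddCommGroup E] [InnerProductSpace ℝ E]

/-- The polarization identity that makes the proximal terms of consecutive steps telescope. -/
theorem inner_positive_sub {P : E →L[ℝ] E} (hP : P.IsPositive) (x y : E) :
    2 * inner ℝ (P (y - x)) y =
      inner ℝ (P y) y - inner ℝ (P x) x + inner ℝ (P (y - x)) (y - x) := by
  have h : inner ℝ (P x) y = inner ℝ (P y) x := by
    rw [hP.inner_left_eq_inner_right, real_inner_comm]
  simp only [map_sub, inner_sub_left, inner_sub_right]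
  linarith

theorem abs_inner_positive_le {P : E →L[ℝ] E} (hP : P.IsPositive) (x y : E) :
    2 * |inner ℝ (P x) y| ≤ inner ℝ (P x) x + inner ℝ (P y) y := by
  have h : inner ℝ (P y) x = inner ℝ (P x) y := by
    rw [hP.inner_left_eq_inner_right, real_inner_comm]
  have h1 := hP.inner_nonneg_left (x - y)
  have h2 := hP.inner_nonneg_left (x + y)
  simp only [map_sub, map_add, inner_sub_left, inner_sub_right, inner_add_left,
    inner_add_right] at h1 h2
  rcases abs_cases (inner ℝ (P x) y) with ⟨h3, -⟩ | ⟨h3, -⟩ <;> linarith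

/-- The Cauchy–Schwarz inequality for the semi-inner product of `P`, applied to `x` and `P x`. -/
theorem norm_positive_sq_le {P : E →L[ℝ] E} (hP : P.IsPositive) (x : E) :
    ‖P x‖ ^ 2 ≤ ‖P‖ * inner ℝ (P x) x := by
  rcases (norm_nonneg P).eq_or_lt with h0 | h0
  · have : P = 0 := norm_eq_zero.mp h0.symm
    simp [this]
  · have h := hP.inner_nonneg_left (‖P‖ • x - P x)
    have h1 : inner ℝ (P (P x)) x = ‖P x‖ ^ 2 := by
      rw [hP.inner_left_eq_inner_right, real_inner_self_eq_norm_sq]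
    have h2 : inner ℝ (P (P x)) (P x) ≤ ‖P‖ * ‖P x‖ ^ 2 := by
      refine (real_inner_le_norm _ _).trans ?_
      rw [pow_two, ← mul_assoc]
      exact mul_le_mul_of_nonneg_right (P.le_opNorm _) (norm_nonneg _)
    simp only [map_sub, map_smul, inner_sub_left, inner_sub_right, real_inner_smul_left,
      real_inner_smul_right, h1, real_inner_self_eq_norm_sq] at h
    -- `h` reads `0 ≤ ‖P‖² ⟪P x, x⟫ - 2 ‖P‖ ‖P x‖² + ⟪P² x, P x⟫`.
    have h3 : 0 ≤ ‖P‖ * (‖P‖ * inner ℝ (P x) x - ‖P x‖ ^ 2) := by linarith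
    exact sub_nonneg.mp (nonneg_of_mul_nonneg_right h3 h0)

theorem tendsto_zero_of_inner_positive {P : E →L[ℝ] E} (hP : P.IsPositive) {ι : Type*}
    {U : Filter ι} {x : ι → E} (h : Tendsto (fun k => inner ℝ (P (x k)) (x k)) U (𝓝 0)) :
    Tendsto (fun k => P (x k)) U (𝓝 0) := by
  rw [tendsto_zero_iff_norm_tendsto_zero]
  have h1 : Tendsto (fun k => ‖P (x k)‖ ^ 2) U (𝓝 0) :=
    squeeze_zero (fun k => by positivity) (fun k => norm_positive_sq_le hP (x k))
      (by simpa using h.const_mul ‖P‖)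
  simpa using h1.sqrt

end PositiveOperators

/-! ### Saddle points -/

section SaddlePoints

variable {X Y Z : Type*}
  [NormedAddCommGroup X] [InnerProductSpace ℝ X]
  [NormedAddCommGroup Y] [InnerProductSpace ℝ Y]
  [NormedAddCommGroup Z] [InnerProductSpace ℝ Z]
  {F : X → EReal} {G : Y → EReal} {A : X →L[ℝ] Z} {B : Y →L[ℝ] Z} {c : Z}
  {us : X} {ps : Y} {ls : Z}

theorem lagrangian_eq_coe (hF : IsGammaZero F) (hG : IsGammaZero G) {u : X} {p : Y}
    (hu : F u ≠ ⊤) (hp : G p ≠ ⊤) (l : Z) :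
    lagrangian F G A B c u p l =
      (((F u).toReal + (G p).toReal + inner ℝ l (A u + B p - c) : ℝ) : EReal) := by
  rw [lagrangian, EReal.coe_add, EReal.coe_add, hF.coe_toReal hu, hG.coe_toReal hp]

theorem lagrangian_eq_top (hF : IsGammaZero F) (hG : IsGammaZero G) {u : X} {p : Y}
    (h : F u = ⊤ ∨ G p = ⊤) (l : Z) : lagrangian F G A B c u p l = ⊤ := by
  rw [lagrangian]
  rcases h with h | h
  · rw [h, EReal.top_add_of_ne_bot (hG.ne_bot p), EReal.top_add_coe]
  · rw [h, EReal.add_top_of_ne_bot (hF.ne_bot u), EReal.top_add_coe]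

theorem IsSaddlePoint.ne_top (hF : IsGammaZero F) (hG : IsGammaZero G)
    (h : IsSaddlePoint F G A B c us ps ls) : F us ≠ ⊤ ∧ G ps ≠ ⊤ := by
  obtain ⟨u, hu⟩ := hF.exists_ne_top
  obtain ⟨p, hp⟩ := hG.exists_ne_top
  have h1 := h.2 u p
  rw [lagrangian_eq_coe hF hG hu hp] at h1
  by_contra hcon
  rw [lagrangian_eq_top hF hG (by tauto)] at h1
  exact EReal.coe_ne_top _ (top_le_iff.mp h1)

theorem IsSaddlePoint.feasible (hF : IsGammaZero F) (hG : IsGammaZero G)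
    (h : IsSaddlePoint F G A B c us ps ls) : A us + B ps = c := by
  obtain ⟨hu, hp⟩ := h.ne_top hF hG
  have h1 := h.1 (ls + (A us + B ps - c))
  rw [lagrangian_eq_coe hF hG hu hp, lagrangian_eq_coe hF hG hu hp, EReal.coe_le_coe_iff,
    inner_add_left] at h1
  have h2 : inner ℝ (A us + B ps - c) (A us + B ps - c) ≤ 0 := by linarith
  exact sub_eq_zero.mp (real_inner_self_nonpos.mp h2)

theorem IsSaddlePoint.le_real (hF : IsGammaZero F) (hG : IsGammaZero G)
    (h : IsSaddlePoint F G A B c us ps ls) {u : X} {p : Y} (hu : F u ≠ ⊤) (hp : G p ≠ ⊤) :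
    (F us).toReal + (G ps).toReal ≤
      (F u).toReal + (G p).toReal + inner ℝ ls (A u + B p - c) := by
  obtain ⟨hus, hps⟩ := h.ne_top hF hG
  have h1 := h.2 u p
  rw [lagrangian_eq_coe hF hG hus hps, lagrangian_eq_coe hF hG hu hp, EReal.coe_le_coe_iff,
    h.feasible hF hG, sub_self, inner_zero_right, add_zero] at h1
  exact h1

/-- Feasibility together with minimality of the Lagrangian over the finite points characterizes
saddle points. -/
theorem isSaddlePoint_of_le (hF : IsGammaZero F) (hG : IsGammaZero G) (hc : A us + B ps = c)
    (h : ∀ u p, F u ≠ ⊤ → G p ≠ ⊤ → F us + G ps ≤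
      (((F u).toReal + (G p).toReal + inner ℝ ls (A u + B p - c) : ℝ) : EReal)) :
    IsSaddlePoint F G A B c us ps ls := by
  have h0 : ∀ l, lagrangian F G A B c us ps l = F us + G ps := by
    intro l
    rw [lagrangian, hc, sub_self, inner_zero_right, EReal.coe_zero, add_zero]
  refine ⟨fun l => by rw [h0, h0], fun u p => ?_⟩
  rw [h0]
  by_cases hup : F u = ⊤ ∨ G p = ⊤
  · rw [lagrangian_eq_top hF hG hup]
    exact le_top
  · push Not at hup
    rw [lagrangian_eq_coe hF hG hup.1 hup.2]
    exact h u p hup.1 hup.2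

theorem IsSaddlePoint.isSolution (hF : IsGammaZero F) (hG : IsGammaZero G)
    (h : IsSaddlePoint F G A B c us ps ls) : IsSolution F G A B c us ps := by
  refine ⟨h.feasible hF hG, fun u p hup => ?_⟩
  have h1 := h.2 u p
  rwa [lagrangian, lagrangian, h.feasible hF hG, hup, sub_self, inner_zero_right, EReal.coe_zero,
    add_zero, add_zero] at h1

/-- The gap relative to a saddle point does not depend on the third component of the evaluation
point, since the saddle point is feasible. -/
theorem IsSaddlePoint.partialGap_eq (hF : IsGammaZero F) (hG : IsGammaZero G)
    (h : IsSaddlePoint F G A B c us ps ls) {u : X} {p : Y} (hu : F u ≠ ⊤) (hp : G p ≠ ⊤) (l : Z) :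
    partialGap F G A B c us ps ls u p l =
      (((F u).toReal + (G p).toReal + inner ℝ ls (A u + B p - c)
        - ((F us).toReal + (G ps).toReal) : ℝ) : EReal) := by
  obtain ⟨hus, hps⟩ := h.ne_top hF hG
  rw [partialGap, lagrangian_eq_coe hF hG hu hp, lagrangian_eq_coe hF hG hus hps,
    h.feasible hF hG, sub_self, inner_zero_right, add_zero, ← EReal.coe_sub]

theorem IsSaddlePoint.subdiff_left [CompleteSpace X] [CompleteSpace Z]
    (hF : IsGammaZero F) (hG : IsGammaZero G)
    (h : IsSaddlePoint F G A B c us ps ls) : -A.adjoint ls ∈ subdiff F us := by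
  obtain ⟨hus, hps⟩ := h.ne_top hF hG
  intro u
  by_cases hu : F u = ⊤
  · rw [hu]
    exact le_top
  have h1 := h.le_real hF hG hu hps
  rw [← hF.coe_toReal hu, ← hF.coe_toReal hus, ← EReal.coe_add, EReal.coe_le_coe_iff,
    inner_neg_left, ContinuousLinearMap.adjoint_inner_left, map_sub]
  have h2 : A u + B ps - c = A u - A us := by
    rw [← h.feasible hF hG]
    abel
  rw [h2] at h1
  linarith

theorem IsSaddlePoint.subdiff_right [CompleteSpace Y] [CompleteSpace Z]
    (hF : IsGammaZero F) (hG : IsGammaZero G)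
    (h : IsSaddlePoint F G A B c us ps ls) : -B.adjoint ls ∈ subdiff G ps := by
  obtain ⟨hus, hps⟩ := h.ne_top hF hG
  intro p
  by_cases hp : G p = ⊤
  · rw [hp]
    exact le_top
  have h1 := h.le_real hF hG hus hp
  rw [← hG.coe_toReal hp, ← hG.coe_toReal hps, ← EReal.coe_add, EReal.coe_le_coe_iff,
    inner_neg_left, ContinuousLinearMap.adjoint_inner_left, map_sub]
  have h2 : A us + B p - c = B p - B ps := by
    rw [← h.feasible hF hG]
    abel
  rw [h2] at h1
  linarith

end SaddlePoints

/-! ### The energy and its one-step decrease -/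

section Energy

variable {Z : Type*} [NormedAddCommGroup Z] [InnerProductSpace ℝ Z]

/-- The multiplier part of the Lyapunov function, in the displacement `z` of the multiplier and
the displacement `b` of `B p`. It equals `‖z - r b‖² / (2 r ρ) + ⟪z, b⟫`; the form chosen here
shows that it is positive definite for `0 < ρ < 2` and antitone in `ρ`. -/
noncomputable def energy (r ρ : ℝ) (z b : Z) : ℝ :=
  ((2 / ρ - 1) * ‖z - r • b‖ ^ 2 + ‖z + r • b‖ ^ 2) / (4 * r)

theorem energy_expand {r ρ : ℝ} (hr : 0 < r) (hρ : 0 < ρ) (z b : Z) :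
    energy r ρ z b =
      1 / ρ * (‖z‖ ^ 2 / (2 * r) + r * ‖b‖ ^ 2 / 2) + (1 - 1 / ρ) * inner ℝ z b := by
  rw [energy, norm_sub_sq_real, norm_add_sq_real, norm_smul, real_inner_smul_right, mul_pow,
    Real.norm_eq_abs, sq_abs]
  field_simp
  ring

/-- The exact balance of one step of the relaxed iteration in the multiplier variables. -/
theorem energy_step {r ρ : ℝ} (hr : 0 < r) (hρ : 0 < ρ) {z z' a b b' : Z}
    (hz : z' = z + r • (ρ • (a + b) + (b' - b))) :
    -inner ℝ (z + r • (a + b)) a - inner ℝ z' b' =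
      energy r ρ z b - energy r ρ z' b' - r * (2 - ρ) / 2 * ‖a + b‖ ^ 2 := by
  rw [energy_expand hr hρ, energy_expand hr hρ, hz]
  simp only [← real_inner_self_eq_norm_sq, inner_add_left, inner_add_right, inner_sub_left,
    inner_sub_right, real_inner_smul_left, real_inner_smul_right]
  rw [real_inner_comm z a, real_inner_comm z b, real_inner_comm z b', real_inner_comm a b,
    real_inner_comm a b', real_inner_comm b b']
  field_simp
  ring

theorem energy_antitone {r ρ ρ' : ℝ} (hr : 0 < r) (hρ : 0 < ρ) (h : ρ ≤ ρ') (z b : Z) :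
    energy r ρ' z b ≤ energy r ρ z b := by
  unfold energy
  gcongr

theorem energy_lower_bound {r ρ κ : ℝ} (hr : 0 < r) (hκ : κ ≤ 1) (h : κ ≤ 2 / ρ - 1) (z b : Z) :
    κ * (‖z‖ ^ 2 + r ^ 2 * ‖b‖ ^ 2) / (2 * r) ≤ energy r ρ z b := by
  have h1 : κ * (‖z‖ ^ 2 + r ^ 2 * ‖b‖ ^ 2) / (2 * r) =
      (κ * ‖z - r • b‖ ^ 2 + κ * ‖z + r • b‖ ^ 2) / (4 * r) := by
    rw [norm_sub_sq_real, norm_add_sq_real, norm_smul, mul_pow, Real.norm_eq_abs, sq_abs]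
    field_simp
    ring
  rw [h1, energy]
  have h2 : κ * ‖z + r • b‖ ^ 2 ≤ ‖z + r • b‖ ^ 2 := mul_le_of_le_one_left (sq_nonneg _) hκ
  gcongr

theorem energy_add (r ρ : ℝ) (z b z' b' : Z) :
    energy r ρ (z + z') (b + b') = energy r ρ z b + energy r ρ z' b' +
      ((2 / ρ - 1) * inner ℝ (z' - r • b') (z - r • b) + inner ℝ (z' + r • b') (z + r • b))
        / (2 * r) := by
  have h1 : z + z' - r • (b + b') = (z - r • b) + (z' - r • b') := by module
  have h2 : z + z' + r • (b + b') = (z + r • b) + (z' + r • b') := by module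
  rw [energy, energy, energy, h1, h2, norm_add_sq_real (z - r • b), norm_add_sq_real (z + r • b),
    real_inner_comm (z - r • b), real_inner_comm (z + r • b)]
  ring

variable {X Y : Type*} [NormedAddCommGroup X] [InnerProductSpace ℝ X]
  [NormedAddCommGroup Y] [InnerProductSpace ℝ Y]

/-- The Lyapunov function of the iteration, in the displacements of the three variables from a
saddle point. -/
noncomputable def lyapunov (B : Y →L[ℝ] Z) (P : X →L[ℝ] X) (Q : Y →L[ℝ] Y) (r ρ : ℝ)
    (x : X) (y : Y) (z : Z) : ℝ :=
  energy r ρ z (B y) + inner ℝ (P x) x / 2 + inner ℝ (Q y) y / 2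

theorem lyapunov_neg (B : Y →L[ℝ] Z) (P : X →L[ℝ] X) (Q : Y →L[ℝ] Y) (r τ : ℝ)
    (x : X) (y : Y) (z : Z) :
    lyapunov B P Q r τ (-x) (-y) (-z) = lyapunov B P Q r τ x y z := by
  have h1 : energy r τ (-z) (-B y) = energy r τ z (B y) := by
    rw [energy, energy, smul_neg, neg_sub_neg, ← neg_add, norm_neg, norm_sub_rev]
  simp only [lyapunov, map_neg, inner_neg_neg, h1]

theorem lyapunov_add {P : X →L[ℝ] X} {Q : Y →L[ℝ] Y} (hP : P.IsPositive) (hQ : Q.IsPositive)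
    (B : Y →L[ℝ] Z) (r τ : ℝ) (x x' : X) (y y' : Y) (z z' : Z) :
    lyapunov B P Q r τ (x + x') (y + y') (z + z') =
      lyapunov B P Q r τ x y z + lyapunov B P Q r τ x' y' z' +
      (((2 / τ - 1) * inner ℝ (z' - r • B y') (z - r • B y) +
        inner ℝ (z' + r • B y') (z + r • B y)) / (2 * r) +
        inner ℝ (P x') x + inner ℝ (Q y') y) := by
  have h1 : inner ℝ (P x) x' = inner ℝ (P x') x := by
    rw [hP.inner_left_eq_inner_right, real_inner_comm]
  have h2 : inner ℝ (Q y) y' = inner ℝ (Q y') y := by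
    rw [hQ.inner_left_eq_inner_right, real_inner_comm]
  rw [lyapunov, lyapunov, lyapunov, map_add, energy_add]
  simp only [map_add, inner_add_left, inner_add_right, h1, h2]
  ring

end Energy

/-! ### The iteration as a system of subgradient inclusions -/

section Run

variable {X Y Z : Type*}
  [NormedAddCommGroup X] [InnerProductSpace ℝ X] [CompleteSpace X]
  [NormedAddCommGroup Y] [InnerProductSpace ℝ Y] [CompleteSpace Y]
  [NormedAddCommGroup Z] [InnerProductSpace ℝ Z] [CompleteSpace Z]

/-- The iteration with the resolvents unfolded. Here `P = N - r A*A` and `Q = M - r B*B` are the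
preconditioner gaps, `σ` is the limit of the relaxation parameters, and `strong_u`, `strong_p`
express strong monotonicity of `r A*A + ∂F` and `r B*B + ∂G`. -/
structure IsRelaxedRun (F : X → EReal) (G : Y → EReal) (A : X →L[ℝ] Z) (B : Y →L[ℝ] Z) (c : Z)
    (r : ℝ) (ρ : ℕ → ℝ) (σ : ℝ) (P : X →L[ℝ] X) (Q : Y →L[ℝ] Y)
    (u : ℕ → X) (p : ℕ → Y) (l : ℕ → Z) : Prop where
  gamma_u : IsGammaZero F
  gamma_p : IsGammaZero G
  r_pos : 0 < r
  pos_u : P.IsPositive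
  pos_p : Q.IsPositive
  rho_pos : ∀ k, 0 < ρ k
  rho_mono : Monotone ρ
  rho_tendsto : Tendsto ρ atTop (𝓝 σ)
  limit_lt : σ < 2
  strong_u : ∃ m : ℝ, 0 < m ∧ ∀ x y, ∀ ξ ∈ subdiff F x, ∀ η ∈ subdiff F y,
    m * ‖x - y‖ ^ 2 ≤ inner ℝ (ξ - η) (x - y) + r * ‖A (x - y)‖ ^ 2
  strong_p : ∃ m : ℝ, 0 < m ∧ ∀ x y, ∀ ξ ∈ subdiff G x, ∀ η ∈ subdiff G y,
    m * ‖x - y‖ ^ 2 ≤ inner ℝ (ξ - η) (x - y) + r * ‖B (x - y)‖ ^ 2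
  sub_u : ∀ k, -A.adjoint (l k + r • (A (u (k + 1)) + B (p k) - c)) - P (u (k + 1) - u k) ∈
    subdiff F (u (k + 1))
  sub_p : ∀ k, -B.adjoint (l (k + 1)) - Q (p (k + 1) - p k) ∈ subdiff G (p (k + 1))
  step_l : ∀ k, l (k + 1) = l k +
    r • (ρ k • (A (u (k + 1)) + B (p k) - c) + (B (p (k + 1)) - B (p k)))

theorem exists_modulus_of_isStronglyMonotone {F : X → EReal} {A : X →L[ℝ] Z} {r : ℝ}
    (h : IsStronglyMonotone (addOp (r • (A.adjoint ∘L A)) (subdiff F))) :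
    ∃ m : ℝ, 0 < m ∧ ∀ x y, ∀ ξ ∈ subdiff F x, ∀ η ∈ subdiff F y,
      m * ‖x - y‖ ^ 2 ≤ inner ℝ (ξ - η) (x - y) + r * ‖A (x - y)‖ ^ 2 := by
  obtain ⟨m, hm, h⟩ := h.exists_modulus
  refine ⟨m, hm, fun x y ξ hξ η hη => (h x y ξ hξ η hη).trans_eq ?_⟩
  simp only [smul_apply, ContinuousLinearMap.comp_apply,
    real_inner_smul_left, ContinuousLinearMap.adjoint_inner_left, real_inner_self_eq_norm_sq]

theorem IsRpFADMM.isRelaxedRun {F : X → EReal} {G : Y → EReal} (hF : IsGammaZero F)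
    (hG : IsGammaZero G) {A : X →L[ℝ] Z} {B : Y →L[ℝ] Z} {c : Z} {r : ℝ} (hr : 0 < r)
    (hAF : IsStronglyMonotone (addOp (r • (A.adjoint ∘L A)) (subdiff F)))
    (hBG : IsStronglyMonotone (addOp (r • (B.adjoint ∘L B)) (subdiff G)))
    {N : X →L[ℝ] X} {M : Y →L[ℝ] Y}
    (hNA : (N - r • (A.adjoint ∘L A)).IsPositive)
    (hMB : (M - r • (B.adjoint ∘L B)).IsPositive)
    {ρ : ℕ → ℝ} {σ : ℝ} (hρ : ∀ k, 0 < ρ k) (hρmono : Monotone ρ)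
    (hσ : Tendsto ρ atTop (𝓝 σ)) (hσ2 : σ < 2)
    {u : ℕ → X} {p : ℕ → Y} {l : ℕ → Z} (h : IsRpFADMM F G A B c r ρ N M u p l) :
    IsRelaxedRun F G A B c r ρ σ (N - r • (A.adjoint ∘L A)) (M - r • (B.adjoint ∘L B))
      u p l where
  gamma_u := hF
  gamma_p := hG
  r_pos := hr
  pos_u := hNA
  pos_p := hMB
  rho_pos := hρ
  rho_mono := hρmono
  rho_tendsto := hσ
  limit_lt := hσ2
  strong_u := exists_modulus_of_isStronglyMonotone hAF
  strong_p := exists_modulus_of_isStronglyMonotone hBG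
  sub_u k := by
    obtain ⟨ξ, hξ, he⟩ := h.step_u k
    convert hξ using 1
    rw [← sub_eq_iff_eq_add'.mpr he]
    simp only [map_add, map_sub, map_neg, map_smul, sub_apply,
      smul_apply, ContinuousLinearMap.comp_apply]
    module
  sub_p k := by
    obtain ⟨ξ, hξ, he⟩ := h.step_p k
    convert hξ using 1
    rw [← sub_eq_iff_eq_add'.mpr he, h.step_l k]
    simp only [map_add, map_sub, map_neg, map_smul, sub_apply,
      smul_apply, ContinuousLinearMap.comp_apply]
    module
  step_l k := by
    rw [h.step_l k]
    module

/-! ### The fundamental estimate and the ergodic rate -/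

/-- The value of the partial gap relative to a saddle point, as a real number. The coercions from
`EReal` are faithful where `F` and `G` are finite, which holds at all iterates with positive
index. -/
noncomputable def realGap (F : X → EReal) (G : Y → EReal) (A : X →L[ℝ] Z) (B : Y →L[ℝ] Z) (c : Z)
    (us : X) (ps : Y) (ls : Z) (u : X) (p : Y) : ℝ :=
  (F u).toReal + (G p).toReal + inner ℝ ls (A u + B p - c) - ((F us).toReal + (G ps).toReal)

namespace IsRelaxedRun

variable {F : X → EReal} {G : Y → EReal} {A : X →L[ℝ] Z} {B : Y →L[ℝ] Z} {c : Z}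
  {r : ℝ} {ρ : ℕ → ℝ} {σ : ℝ} {P : X →L[ℝ] X} {Q : Y →L[ℝ] Y}
  {u : ℕ → X} {p : ℕ → Y} {l : ℕ → Z} {us : X} {ps : Y} {ls : Z}

theorem ne_top_u (h : IsRelaxedRun F G A B c r ρ σ P Q u p l) (k : ℕ) : F (u (k + 1)) ≠ ⊤ :=
  h.gamma_u.ne_top_of_mem_subdiff (h.sub_u k)

theorem ne_top_p (h : IsRelaxedRun F G A B c r ρ σ P Q u p l) (k : ℕ) : G (p (k + 1)) ≠ ⊤ :=
  h.gamma_p.ne_top_of_mem_subdiff (h.sub_p k)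

theorem rho_le (h : IsRelaxedRun F G A B c r ρ σ P Q u p l) (k : ℕ) : ρ k ≤ σ :=
  h.rho_mono.ge_of_tendsto h.rho_tendsto k

theorem limit_pos (h : IsRelaxedRun F G A B c r ρ σ P Q u p l) : 0 < σ :=
  (h.rho_pos 0).trans_le (h.rho_le 0)

theorem realGap_nonneg (h : IsRelaxedRun F G A B c r ρ σ P Q u p l)
    (hs : IsSaddlePoint F G A B c us ps ls) (k : ℕ) :
    0 ≤ realGap F G A B c us ps ls (u (k + 1)) (p (k + 1)) :=
  sub_nonneg.mpr (hs.le_real h.gamma_u h.gamma_p (h.ne_top_u k) (h.ne_top_p k))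

/-- The fundamental estimate: the decrease of the Lyapunov function controls both the gap and the
increments of the iteration. -/
theorem descent (h : IsRelaxedRun F G A B c r ρ σ P Q u p l)
    (hs : IsSaddlePoint F G A B c us ps ls) (k : ℕ) :
    realGap F G A B c us ps ls (u (k + 1)) (p (k + 1))
      + r * (2 - ρ k) / 2 * ‖A (u (k + 1)) + B (p k) - c‖ ^ 2
      + inner ℝ (P (u (k + 1) - u k)) (u (k + 1) - u k) / 2
      + inner ℝ (Q (p (k + 1) - p k)) (p (k + 1) - p k) / 2
      + lyapunov B P Q r (ρ (k + 1)) (u (k + 1) - us) (p (k + 1) - ps) (l (k + 1) - ls)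
      ≤ lyapunov B P Q r (ρ k) (u k - us) (p k - ps) (l k - ls) := by
  obtain ⟨hus, hps⟩ := hs.ne_top h.gamma_u h.gamma_p
  have hc := hs.feasible h.gamma_u h.gamma_p
  have hu := h.gamma_u.add_inner_le (h.sub_u k) hus
  have hp := h.gamma_p.add_inner_le (h.sub_p k) hps
  have he : A (u (k + 1)) + B (p k) - c = A (u (k + 1) - us) + B (p k - ps) := by
    rw [← hc, map_sub, map_sub]
    abel
  have hz : l (k + 1) - ls = (l k - ls) +
      r • (ρ k • (A (u (k + 1) - us) + B (p k - ps)) + (B (p (k + 1) - ps) - B (p k - ps))) := by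
    rw [h.step_l k, he, map_sub B (p (k + 1)), map_sub B (p k)]
    module
  have hstep := energy_step h.r_pos (h.rho_pos k) hz
  have hanti := energy_antitone h.r_pos (h.rho_pos k) (h.rho_mono k.le_succ)
    (l (k + 1) - ls) (B (p (k + 1) - ps))
  have hP := inner_positive_sub h.pos_u (u k - us) (u (k + 1) - us)
  have hQ := inner_positive_sub h.pos_p (p k - ps) (p (k + 1) - ps)
  rw [sub_sub_sub_cancel_right] at hP hQ
  have hgap : A (u (k + 1)) + B (p (k + 1)) - c = A (u (k + 1) - us) + B (p (k + 1) - ps) := by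
    rw [← hc, map_sub, map_sub]
    abel
  rw [← neg_sub (u (k + 1)), inner_neg_right, inner_sub_left, inner_neg_left,
    ContinuousLinearMap.adjoint_inner_left, he] at hu
  rw [← neg_sub (p (k + 1)), inner_neg_right, inner_sub_left, inner_neg_left,
    ContinuousLinearMap.adjoint_inner_left] at hp
  rw [realGap, hgap, he, lyapunov, lyapunov, inner_add_right]
  simp only [inner_add_left, inner_sub_left] at hstep hu hp
  linarith

theorem lyapunov_nonneg (h : IsRelaxedRun F G A B c r ρ σ P Q u p l) (k : ℕ)
    (x : X) (y : Y) (z : Z) : 0 ≤ lyapunov B P Q r (ρ k) x y z := by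
  have h1 : 0 ≤ energy r (ρ k) z (B y) := by
    have h2 : 0 ≤ 2 / ρ k - 1 := by
      rw [sub_nonneg, le_div_iff₀ (h.rho_pos k), one_mul]
      exact (h.rho_le k).trans h.limit_lt.le
    have hr := h.r_pos
    unfold energy
    positivity
  have h2 := h.pos_u.inner_nonneg_left x
  have h3 := h.pos_p.inner_nonneg_left y
  unfold lyapunov
  positivity

/-- Summing the fundamental estimate. -/
theorem sum_realGap_le (h : IsRelaxedRun F G A B c r ρ σ P Q u p l)
    (hs : IsSaddlePoint F G A B c us ps ls) (k : ℕ) :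
    ∑ j ∈ Finset.range k, realGap F G A B c us ps ls (u (j + 2)) (p (j + 2)) ≤
      lyapunov B P Q r (ρ 1) (u 1 - us) (p 1 - ps) (l 1 - ls) := by
  have key : ∀ k, ∑ j ∈ Finset.range k, realGap F G A B c us ps ls (u (j + 2)) (p (j + 2)) +
      lyapunov B P Q r (ρ (k + 1)) (u (k + 1) - us) (p (k + 1) - ps) (l (k + 1) - ls) ≤
      lyapunov B P Q r (ρ 1) (u 1 - us) (p 1 - ps) (l 1 - ls) := by
    intro k
    induction k with
    | zero => simp
    | succ k ih =>
      have h1 := h.descent hs (k + 1)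
      have h2 := h.pos_u.inner_nonneg_left (u (k + 1 + 1) - u (k + 1))
      have h3 := h.pos_p.inner_nonneg_left (p (k + 1 + 1) - p (k + 1))
      have h4 : 0 ≤ r * (2 - ρ (k + 1)) / 2 * ‖A (u (k + 1 + 1)) + B (p (k + 1)) - c‖ ^ 2 := by
        have := h.r_pos
        have : 0 ≤ 2 - ρ (k + 1) := sub_nonneg.mpr ((h.rho_le _).trans h.limit_lt.le)
        positivity
      rw [Finset.sum_range_succ]
      linarith
  exact (le_add_of_nonneg_right (h.lyapunov_nonneg _ _ _ _)).trans (key k)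

/-- The ergodic rate, with the initial value of the Lyapunov function as constant. -/
theorem partialGap_ergodic_le (h : IsRelaxedRun F G A B c r ρ σ P Q u p l)
    (hs : IsSaddlePoint F G A B c us ps ls) {k : ℕ} (hk : 1 ≤ k) :
    0 ≤ partialGap F G A B c us ps ls (ergodic u k) (ergodic p k) (ergodic l k) ∧
    partialGap F G A B c us ps ls (ergodic u k) (ergodic p k) (ergodic l k) ≤
      ((1 / (k : ℝ) * lyapunov B P Q r (ρ 1) (u 1 - us) (p 1 - ps) (l 1 - ls) : ℝ) : EReal) := by
  obtain ⟨hu, hu'⟩ := h.gamma_u.map_ergodic_le h.ne_top_u hk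
  obtain ⟨hp, hp'⟩ := h.gamma_p.map_ergodic_le h.ne_top_p hk
  have hk0 : (k : ℝ) ≠ 0 := by positivity
  rw [hs.partialGap_eq h.gamma_u h.gamma_p hu hp]
  constructor
  · exact_mod_cast sub_nonneg.mpr (hs.le_real h.gamma_u h.gamma_p hu hp)
  · rw [EReal.coe_le_coe_iff]
    have hsum := mul_le_mul_of_nonneg_left (h.sum_realGap_le hs k)
      (show (0 : ℝ) ≤ 1 / k by positivity)
    refine le_trans ?_ hsum
    simp only [realGap, inner_add_right, inner_sub_right, Finset.sum_add_distrib,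
      Finset.sum_sub_distrib, Finset.sum_const, Finset.card_range, nsmul_eq_mul, mul_add, mul_sub,
      ← mul_assoc, one_div_mul_cancel hk0, one_mul]
    rw [map_ergodic, map_ergodic, inner_smul_right, inner_smul_right, inner_sum, inner_sum]
    linarith

end IsRelaxedRun

end Run

section Asymptotics

variable {X Y Z : Type*}
  [NormedAddCommGroup X] [InnerProductSpace ℝ X] [CompleteSpace X]
  [NormedAddCommGroup Y] [InnerProductSpace ℝ Y] [CompleteSpace Y]
  [NormedAddCommGroup Z] [InnerProductSpace ℝ Z] [CompleteSpace Z]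

namespace IsRelaxedRun

variable {F : X → EReal} {G : Y → EReal} {A : X →L[ℝ] Z} {B : Y →L[ℝ] Z} {c : Z}
  {r : ℝ} {ρ : ℕ → ℝ} {σ : ℝ} {P : X →L[ℝ] X} {Q : Y →L[ℝ] Y}
  {u : ℕ → X} {p : ℕ → Y} {l : ℕ → Z} {us : X} {ps : Y} {ls : Z}

/-! ### Vanishing increments -/

/-- The fundamental estimate, term by term. -/
theorem increments_le (h : IsRelaxedRun F G A B c r ρ σ P Q u p l)
    (hs : IsSaddlePoint F G A B c us ps ls) (k : ℕ) :
    let D := lyapunov B P Q r (ρ k) (u k - us) (p k - ps) (l k - ls) -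
      lyapunov B P Q r (ρ (k + 1)) (u (k + 1) - us) (p (k + 1) - ps) (l (k + 1) - ls)
    0 ≤ D ∧ r * (2 - σ) / 2 * ‖A (u (k + 1)) + B (p k) - c‖ ^ 2 ≤ D ∧
      inner ℝ (P (u (k + 1) - u k)) (u (k + 1) - u k) / 2 ≤ D ∧
      inner ℝ (Q (p (k + 1) - p k)) (p (k + 1) - p k) / 2 ≤ D := by
  have hr := h.r_pos
  have h1 := h.descent hs k
  have h2 := h.pos_u.inner_nonneg_left (u (k + 1) - u k)
  have h3 := h.pos_p.inner_nonneg_left (p (k + 1) - p k)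
  have h4 := h.realGap_nonneg hs k
  have h5 : 0 ≤ r * (2 - σ) / 2 * ‖A (u (k + 1)) + B (p k) - c‖ ^ 2 := by
    have : 0 < 2 - σ := sub_pos.mpr h.limit_lt
    positivity
  have h6 : r * (2 - σ) / 2 * ‖A (u (k + 1)) + B (p k) - c‖ ^ 2 ≤
      r * (2 - ρ k) / 2 * ‖A (u (k + 1)) + B (p k) - c‖ ^ 2 := by
    have := h.rho_le k
    gcongr
  refine ⟨?_, ?_, ?_, ?_⟩ <;> linarith

theorem lyapunov_antitone (h : IsRelaxedRun F G A B c r ρ σ P Q u p l)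
    (hs : IsSaddlePoint F G A B c us ps ls) :
    Antitone fun k => lyapunov B P Q r (ρ k) (u k - us) (p k - ps) (l k - ls) :=
  antitone_nat_of_succ_le fun k => sub_nonneg.mp (h.increments_le hs k).1

theorem exists_tendsto_lyapunov (h : IsRelaxedRun F G A B c r ρ σ P Q u p l)
    (hs : IsSaddlePoint F G A B c us ps ls) :
    ∃ L, Tendsto (fun k => lyapunov B P Q r (ρ k) (u k - us) (p k - ps) (l k - ls))
      atTop (𝓝 L) :=
  ⟨_, tendsto_atTop_ciInf (h.lyapunov_antitone hs)
    ⟨0, Set.forall_mem_range.mpr fun k => h.lyapunov_nonneg k _ _ _⟩⟩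

theorem tendsto_lyapunov_sub (h : IsRelaxedRun F G A B c r ρ σ P Q u p l)
    (hs : IsSaddlePoint F G A B c us ps ls) :
    Tendsto (fun k => lyapunov B P Q r (ρ k) (u k - us) (p k - ps) (l k - ls) -
      lyapunov B P Q r (ρ (k + 1)) (u (k + 1) - us) (p (k + 1) - ps) (l (k + 1) - ls))
      atTop (𝓝 0) := by
  obtain ⟨L, hL⟩ := h.exists_tendsto_lyapunov hs
  simpa using hL.sub (hL.comp (tendsto_add_atTop_nat 1))

theorem tendsto_residual (h : IsRelaxedRun F G A B c r ρ σ P Q u p l)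
    (hs : IsSaddlePoint F G A B c us ps ls) :
    Tendsto (fun k => A (u (k + 1)) + B (p k) - c) atTop (𝓝 0) := by
  have hσ : 0 < r * (2 - σ) / 2 := by
    have := sub_pos.mpr h.limit_lt
    have := h.r_pos
    positivity
  have h1 : Tendsto (fun k => r * (2 - σ) / 2 * ‖A (u (k + 1)) + B (p k) - c‖ ^ 2)
      atTop (𝓝 0) :=
    squeeze_zero (fun k => by positivity) (fun k => (h.increments_le hs k).2.1)
      (h.tendsto_lyapunov_sub hs)
  rw [tendsto_zero_iff_norm_tendsto_zero]
  have h2 := (h1.const_mul (r * (2 - σ) / 2)⁻¹).sqrt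
  simp only [← mul_assoc, inv_mul_cancel₀ hσ.ne', one_mul, mul_zero, Real.sqrt_zero,
    Real.sqrt_sq (norm_nonneg _)] at h2
  exact h2

theorem tendsto_inner_increment_u (h : IsRelaxedRun F G A B c r ρ σ P Q u p l)
    (hs : IsSaddlePoint F G A B c us ps ls) :
    Tendsto (fun k => inner ℝ (P (u (k + 1) - u k)) (u (k + 1) - u k)) atTop (𝓝 0) := by
  refine squeeze_zero (fun k => h.pos_u.inner_nonneg_left _) (fun k => ?_)
    (by simpa using (h.tendsto_lyapunov_sub hs).const_mul 2)
  have := (h.increments_le hs k).2.2.1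
  linarith

theorem tendsto_inner_increment_p (h : IsRelaxedRun F G A B c r ρ σ P Q u p l)
    (hs : IsSaddlePoint F G A B c us ps ls) :
    Tendsto (fun k => inner ℝ (Q (p (k + 1) - p k)) (p (k + 1) - p k)) atTop (𝓝 0) := by
  refine squeeze_zero (fun k => h.pos_p.inner_nonneg_left _) (fun k => ?_)
    (by simpa using (h.tendsto_lyapunov_sub hs).const_mul 2)
  have := (h.increments_le hs k).2.2.2
  linarith

/-- The increments of `B p` vanish. They do not occur in the fundamental estimate; they are
controlled by monotonicity of `∂G` between two consecutive iterates. -/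
theorem tendsto_increment_map_p (h : IsRelaxedRun F G A B c r ρ σ P Q u p l)
    (hs : IsSaddlePoint F G A B c us ps ls) :
    Tendsto (fun k => B (p (k + 1)) - B (p k)) atTop (𝓝 0) := by
  rw [← tendsto_add_atTop_iff_nat 1, tendsto_zero_iff_norm_tendsto_zero]
  have hr := h.r_pos
  have key : ∀ k, ‖B (p (k + 1 + 1)) - B (p (k + 1))‖ ^ 2 ≤
      4 * ‖A (u (k + 1 + 1)) + B (p (k + 1)) - c‖ ^ 2 +
        r⁻¹ * inner ℝ (Q (p (k + 1) - p k)) (p (k + 1) - p k) := by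
    intro k
    have hmon := h.gamma_p.subdiff_monotone _ _ _ (h.sub_p (k + 1)) _ (h.sub_p k)
    have hrw : -B.adjoint (l (k + 1 + 1)) - Q (p (k + 1 + 1) - p (k + 1)) -
        (-B.adjoint (l (k + 1)) - Q (p (k + 1) - p k)) =
        Q (p (k + 1) - p k) - Q (p (k + 1 + 1) - p (k + 1)) -
          B.adjoint (l (k + 1 + 1) - l (k + 1)) := by
      rw [map_sub B.adjoint]
      abel
    rw [hrw, inner_sub_left, inner_sub_left, ContinuousLinearMap.adjoint_inner_left,
      map_sub B (p (k + 1 + 1)), h.step_l (k + 1), add_sub_cancel_left, real_inner_smul_left,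
      inner_add_left, real_inner_smul_left, real_inner_self_eq_norm_sq] at hmon
    have h1 := abs_inner_positive_le h.pos_p (p (k + 1) - p k) (p (k + 1 + 1) - p (k + 1))
    have h2 := h.pos_p.inner_nonneg_left (p (k + 1 + 1) - p (k + 1))
    have h3 := le_abs_self (inner ℝ (Q (p (k + 1) - p k)) (p (k + 1 + 1) - p (k + 1)))
    set e := A (u (k + 1 + 1)) + B (p (k + 1)) - c
    set d := B (p (k + 1 + 1)) - B (p (k + 1))
    set q := inner ℝ (Q (p (k + 1) - p k)) (p (k + 1) - p k)
    have h4 : 0 ≤ ‖ρ (k + 1) • e + d‖ ^ 2 := by positivity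
    rw [norm_add_sq_real, real_inner_smul_left, norm_smul, mul_pow, Real.norm_eq_abs,
      sq_abs] at h4
    have h5 : ρ (k + 1) ^ 2 * ‖e‖ ^ 2 ≤ 4 * ‖e‖ ^ 2 := by
      have := (h.rho_le (k + 1)).trans h.limit_lt.le
      have := h.rho_pos (k + 1)
      gcongr
      nlinarith
    have h6 : r * (ρ (k + 1) * inner ℝ e d + ‖d‖ ^ 2) ≤ q / 2 := by linarith
    have h7 : ρ (k + 1) * inner ℝ e d + ‖d‖ ^ 2 ≤ r⁻¹ * q / 2 := by
      rw [mul_comm, ← le_div_iff₀ hr] at h6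
      refine h6.trans_eq ?_
      ring
    linarith
  have h1 : Tendsto (fun k => 4 * ‖A (u (k + 1 + 1)) + B (p (k + 1)) - c‖ ^ 2 +
      r⁻¹ * inner ℝ (Q (p (k + 1) - p k)) (p (k + 1) - p k)) atTop (𝓝 0) := by
    have h2 := ((h.tendsto_residual hs).comp (tendsto_add_atTop_nat 1)).norm.pow 2
    simpa using (h2.const_mul 4).add ((h.tendsto_inner_increment_p hs).const_mul r⁻¹)
  simpa using (squeeze_zero (fun k => by positivity) key h1).sqrt

/-! ### Boundedness -/

/-- The energies are coercive with a single constant, because the relaxation parameters stay below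
`σ < 2`. -/
theorem exists_coercivity (h : IsRelaxedRun F G A B c r ρ σ P Q u p l) :
    ∃ κ > 0, ∀ τ, 0 < τ → τ ≤ σ → ∀ z b : Z, κ * (‖z‖ ^ 2 + ‖b‖ ^ 2) ≤ energy r τ z b := by
  have hr := h.r_pos
  have hσ := h.limit_pos
  have h0 : 0 < 2 / σ - 1 := by
    rw [sub_pos, lt_div_iff₀ hσ, one_mul]
    exact h.limit_lt
  set κ := min 1 (2 / σ - 1)
  have hκ : 0 < κ := lt_min one_pos h0
  refine ⟨κ / (2 * r) * min 1 (r ^ 2), by positivity, fun τ hτ hle z b => ?_⟩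
  have h1 : κ ≤ 2 / τ - 1 := (min_le_right _ _).trans (by gcongr)
  refine le_trans ?_ (energy_lower_bound hr (min_le_left _ _) h1 z b)
  have h2 : min 1 (r ^ 2) * ‖z‖ ^ 2 ≤ ‖z‖ ^ 2 :=
    mul_le_of_le_one_left (sq_nonneg _) (min_le_left _ _)
  have h3 : min 1 (r ^ 2) * ‖b‖ ^ 2 ≤ r ^ 2 * ‖b‖ ^ 2 :=
    mul_le_mul_of_nonneg_right (min_le_right _ _) (sq_nonneg _)
  calc κ / (2 * r) * min 1 (r ^ 2) * (‖z‖ ^ 2 + ‖b‖ ^ 2)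
      = κ * (min 1 (r ^ 2) * ‖z‖ ^ 2 + min 1 (r ^ 2) * ‖b‖ ^ 2) / (2 * r) := by ring
    _ ≤ κ * (‖z‖ ^ 2 + r ^ 2 * ‖b‖ ^ 2) / (2 * r) := by gcongr

theorem exists_bound_multiplier (h : IsRelaxedRun F G A B c r ρ σ P Q u p l)
    (hs : IsSaddlePoint F G A B c us ps ls) :
    ∃ C, ∀ k, ‖l k - ls‖ ≤ C ∧ ‖B (p k - ps)‖ ≤ C := by
  obtain ⟨κ, hκ, hcoer⟩ := h.exists_coercivity
  set L := lyapunov B P Q r (ρ 0) (u 0 - us) (p 0 - ps) (l 0 - ls)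
  have key : ∀ k, ‖l k - ls‖ ^ 2 + ‖B (p k - ps)‖ ^ 2 ≤ L / κ := by
    intro k
    rw [le_div_iff₀ hκ, mul_comm]
    refine (hcoer (ρ k) (h.rho_pos k) (h.rho_le k) _ _).trans ?_
    refine le_trans ?_ (h.lyapunov_antitone hs k.zero_le)
    have h1 := h.pos_u.inner_nonneg_left (u k - us)
    have h2 := h.pos_p.inner_nonneg_left (p k - ps)
    simp only [lyapunov]
    linarith
  refine ⟨√(L / κ), fun k => ⟨Real.le_sqrt_of_sq_le ?_, Real.le_sqrt_of_sq_le ?_⟩⟩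
  · linarith [key k, sq_nonneg ‖B (p k - ps)‖]
  · linarith [key k, sq_nonneg ‖l k - ls‖]

/-- The semi-inner products with the increments are bounded below. -/
theorem exists_bound_inner_increment (h : IsRelaxedRun F G A B c r ρ σ P Q u p l)
    (hs : IsSaddlePoint F G A B c us ps ls) :
    ∃ C, ∀ k, -inner ℝ (P (u (k + 1) - u k)) (u (k + 1) - us) ≤ C ∧
      -inner ℝ (Q (p (k + 1) - p k)) (p (k + 1) - ps) ≤ C := by
  refine ⟨lyapunov B P Q r (ρ 0) (u 0 - us) (p 0 - ps) (l 0 - ls), fun k => ?_⟩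
  have hle := h.lyapunov_antitone hs k.zero_le
  obtain ⟨κ, hκ, hcoer⟩ := h.exists_coercivity
  have henergy : 0 ≤ energy r (ρ k) (l k - ls) (B (p k - ps)) :=
    le_trans (by positivity) (hcoer (ρ k) (h.rho_pos k) (h.rho_le k) _ _)
  simp only [lyapunov] at hle ⊢
  have hP := inner_positive_sub h.pos_u (u k - us) (u (k + 1) - us)
  have hQ := inner_positive_sub h.pos_p (p k - ps) (p (k + 1) - ps)
  rw [sub_sub_sub_cancel_right] at hP hQ
  have h1 := h.pos_u.inner_nonneg_left (u k - us)
  have h2 := h.pos_u.inner_nonneg_left (u (k + 1) - us)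
  have h3 := h.pos_u.inner_nonneg_left (u (k + 1) - u k)
  have h4 := h.pos_p.inner_nonneg_left (p k - ps)
  have h5 := h.pos_p.inner_nonneg_left (p (k + 1) - ps)
  have h6 := h.pos_p.inner_nonneg_left (p (k + 1) - p k)
  constructor <;> linarith

theorem exists_bound_residual (h : IsRelaxedRun F G A B c r ρ σ P Q u p l)
    (hs : IsSaddlePoint F G A B c us ps ls) :
    ∃ C, ∀ k, ‖A (u (k + 1)) + B (p k) - c‖ ≤ C := by
  obtain ⟨C, hC⟩ := (h.tendsto_residual hs).norm.bddAbove_range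
  exact ⟨C, fun k => hC ⟨k, rfl⟩⟩

/-- Strong monotonicity of `r A*A + ∂F` turns the bounds on the multipliers and on `A u` into a
bound on `u`. -/
theorem exists_bound_u (h : IsRelaxedRun F G A B c r ρ σ P Q u p l)
    (hs : IsSaddlePoint F G A B c us ps ls) : ∃ C, ∀ k, ‖u (k + 1)‖ ≤ C := by
  obtain ⟨m, hm, hstrong⟩ := h.strong_u
  obtain ⟨C1, hC1⟩ := h.exists_bound_multiplier hs
  obtain ⟨C2, hC2⟩ := h.exists_bound_inner_increment hs
  obtain ⟨C3, hC3⟩ := h.exists_bound_residual hs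
  have hr := h.r_pos
  have hc := hs.feasible h.gamma_u h.gamma_p
  have key : ∀ k, ‖u (k + 1) - us‖ ^ 2 ≤ ((C1 + r * C1) * (C3 + C1) + C2) / m := by
    intro k
    rw [le_div_iff₀ hm, mul_comm]
    refine (hstrong _ _ _ (h.sub_u k) _ (hs.subdiff_left h.gamma_u h.gamma_p)).trans ?_
    have he : A (u (k + 1)) + B (p k) - c = A (u (k + 1) - us) + B (p k - ps) := by
      rw [← hc, map_sub, map_sub]
      abel
    have hC3' := hC3 k
    have hrw : -A.adjoint (l k + r • (A (u (k + 1)) + B (p k) - c)) - P (u (k + 1) - u k) -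
        -A.adjoint ls = -A.adjoint (l k - ls + r • (A (u (k + 1)) + B (p k) - c)) -
          P (u (k + 1) - u k) := by
      simp only [map_add, map_sub]
      abel
    rw [hrw, inner_sub_left, inner_neg_left, ContinuousLinearMap.adjoint_inner_left, he]
    rw [he] at hC3'
    set a := A (u (k + 1) - us)
    set b := B (p k - ps)
    set z := l k - ls
    have h1 : -inner ℝ (z + r • (a + b)) a + r * ‖a‖ ^ 2 = -inner ℝ (z + r • b) a := by
      simp only [inner_add_left, smul_add, real_inner_smul_left, real_inner_self_eq_norm_sq]
      ring
    have h2 : ‖a‖ ≤ C3 + C1 := by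
      have h3 := norm_sub_le (a + b) b
      rw [add_sub_cancel_right] at h3
      linarith [(hC1 k).2]
    have h3 : ‖z + r • b‖ ≤ C1 + r * C1 := by
      refine (norm_add_le _ _).trans ?_
      rw [norm_smul, Real.norm_of_nonneg hr.le]
      have := hC1 k
      gcongr
      exacts [this.1, this.2]
    have h4 : -inner ℝ (z + r • b) a ≤ (C1 + r * C1) * (C3 + C1) :=
      ((neg_le_abs _).trans (abs_real_inner_le_norm _ _)).trans
        (mul_le_mul h3 h2 (norm_nonneg _) ((norm_nonneg _).trans h3))
    linarith [(hC2 k).1]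
  refine ⟨√(((C1 + r * C1) * (C3 + C1) + C2) / m) + ‖us‖, fun k => ?_⟩
  have h1 := Real.le_sqrt_of_sq_le (key k)
  have h2 := norm_sub_norm_le (u (k + 1)) us
  linarith

/-- The analogue of `exists_bound_u` for `p`, from the bounds on `l` and `B p`. -/
theorem exists_bound_p (h : IsRelaxedRun F G A B c r ρ σ P Q u p l)
    (hs : IsSaddlePoint F G A B c us ps ls) : ∃ C, ∀ k, ‖p (k + 1)‖ ≤ C := by
  obtain ⟨m, hm, hstrong⟩ := h.strong_p
  obtain ⟨C1, hC1⟩ := h.exists_bound_multiplier hs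
  obtain ⟨C2, hC2⟩ := h.exists_bound_inner_increment hs
  have hr := h.r_pos
  have key : ∀ k, ‖p (k + 1) - ps‖ ^ 2 ≤ (C1 * C1 + C2 + r * C1 ^ 2) / m := by
    intro k
    rw [le_div_iff₀ hm, mul_comm]
    refine (hstrong _ _ _ (h.sub_p k) _ (hs.subdiff_right h.gamma_u h.gamma_p)).trans ?_
    have hrw : -B.adjoint (l (k + 1)) - Q (p (k + 1) - p k) - -B.adjoint ls =
        -B.adjoint (l (k + 1) - ls) - Q (p (k + 1) - p k) := by
      rw [map_sub B.adjoint]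
      abel
    rw [hrw, inner_sub_left, inner_neg_left, ContinuousLinearMap.adjoint_inner_left]
    obtain ⟨h1, h2⟩ := hC1 (k + 1)
    have h3 : -inner ℝ (l (k + 1) - ls) (B (p (k + 1) - ps)) ≤ C1 * C1 :=
      ((neg_le_abs _).trans (abs_real_inner_le_norm _ _)).trans
        (mul_le_mul h1 h2 (norm_nonneg _) ((norm_nonneg _).trans h1))
    have h4 : r * ‖B (p (k + 1) - ps)‖ ^ 2 ≤ r * C1 ^ 2 := by gcongr
    linarith [(hC2 k).2]
  refine ⟨√((C1 * C1 + C2 + r * C1 ^ 2) / m) + ‖ps‖, fun k => ?_⟩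
  have h1 := Real.le_sqrt_of_sq_le (key k)
  have h2 := norm_sub_norm_le (p (k + 1)) ps
  linarith

theorem exists_bound_l (h : IsRelaxedRun F G A B c r ρ σ P Q u p l)
    (hs : IsSaddlePoint F G A B c us ps ls) : ∃ C, ∀ k, ‖l (k + 1)‖ ≤ C := by
  obtain ⟨C, hC⟩ := h.exists_bound_multiplier hs
  refine ⟨C + ‖ls‖, fun k => ?_⟩
  linarith [(hC (k + 1)).1, norm_sub_norm_le (l (k + 1)) ls]

/-! ### Weak cluster points -/

/-- A weak cluster point along a filter is a saddle point: its feasibility comes from the vanishing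
residual, and minimality of the Lagrangian from the subgradient inequalities, in which all error
terms vanish, and from weak lower semicontinuity of `F` and `G`. -/
theorem isSaddlePoint_of_weakTendsto (h : IsRelaxedRun F G A B c r ρ σ P Q u p l)
    (hs : IsSaddlePoint F G A B c us ps ls) {U : Filter ℕ} [U.NeBot] (hU : U ≤ atTop)
    {ua : X} {pa : Y} {la : Z} (hu : WeakTendsto (fun k => u (k + 1)) U ua)
    (hp : WeakTendsto (fun k => p (k + 1)) U pa) (hl : WeakTendsto (fun k => l (k + 1)) U la) :
    IsSaddlePoint F G A B c ua pa la := by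
  have hdB := (h.tendsto_increment_map_p hs).mono_left hU
  have he := (h.tendsto_residual hs).mono_left hU
  have hres : Tendsto (fun k => A (u (k + 1)) + B (p (k + 1)) - c) U (𝓝 0) := by
    have h1 := he.add hdB
    rw [add_zero] at h1
    exact h1.congr fun k => by abel
  have hPinc := (tendsto_zero_of_inner_positive h.pos_u
    (h.tendsto_inner_increment_u hs)).mono_left hU
  have hQinc := (tendsto_zero_of_inner_positive h.pos_p
    (h.tendsto_inner_increment_p hs)).mono_left hU
  -- The multiplier in the inclusion for `u` differs from `l (k + 1)` by a null sequence.
  have hmult : Tendsto (fun k => l k + r • (A (u (k + 1)) + B (p k) - c) - l (k + 1)) U (𝓝 0) := by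
    have h1 := ((he.const_smul (1 : ℝ)).sub
      ((h.rho_tendsto.mono_left hU).smul he)).sub hdB
    have h2 := h1.const_smul r
    simp only [smul_zero, sub_zero] at h2
    refine h2.congr fun k => ?_
    rw [h.step_l k]
    module
  have hfeas : A ua + B pa = c := by
    rw [← sub_eq_zero]
    refine ext_inner_left ℝ fun y => ?_
    rw [inner_zero_right]
    have h1 := ((weakTendsto_iff_inner.mp (hu.map A) y).add
      (weakTendsto_iff_inner.mp (hp.map B) y)).sub_const (inner ℝ y c)
    simp only [← inner_add_right, ← inner_sub_right] at h1
    have h2 : Tendsto (fun k => inner ℝ y (A (u (k + 1)) + B (p (k + 1)) - c)) U (𝓝 0) := by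
      simpa using (tendsto_const_nhds (x := y)).inner hres
    exact tendsto_nhds_unique h1 h2
  obtain ⟨Cu, hCu⟩ := h.exists_bound_u hs
  obtain ⟨Cp, hCp⟩ := h.exists_bound_p hs
  obtain ⟨Cl, hCl⟩ := h.exists_bound_l hs
  refine isSaddlePoint_of_le h.gamma_u h.gamma_p hfeas fun u' p' hu' hp' => ?_
  have hbu : ∀ k, ‖u' - u (k + 1)‖ ≤ ‖u'‖ + Cu := fun k =>
    (norm_sub_le _ _).trans (add_le_add_right (hCu k) _)
  have hbp : ∀ k, ‖p' - p (k + 1)‖ ≤ ‖p'‖ + Cp := fun k =>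
    (norm_sub_le _ _).trans (add_le_add_right (hCp k) _)
  have hbA : ∀ k, ‖A (u' - u (k + 1))‖ ≤ ‖A‖ * (‖u'‖ + Cu) := fun k =>
    (A.le_opNorm _).trans (mul_le_mul_of_nonneg_left (hbu k) (norm_nonneg _))
  -- `S k` is the upper bound for `F (u (k + 1)) + G (p (k + 1))` given by the inclusions.
  let S : ℕ → ℝ := fun k => (F u').toReal + (G p').toReal +
    inner ℝ (A u' + B p' - c) (l (k + 1)) -
    inner ℝ (A (u (k + 1)) + B (p (k + 1)) - c) (l (k + 1)) +
    inner ℝ (l k + r • (A (u (k + 1)) + B (p k) - c) - l (k + 1)) (A (u' - u (k + 1))) +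
    inner ℝ (P (u (k + 1) - u k)) (u' - u (k + 1)) +
    inner ℝ (Q (p (k + 1) - p k)) (p' - p (k + 1))
  have hS : Tendsto S U
      (𝓝 ((F u').toReal + (G p').toReal + inner ℝ la (A u' + B p' - c))) := by
    have h1 := (((((weakTendsto_iff_inner.mp hl (A u' + B p' - c)).const_add
      ((F u').toReal + (G p').toReal)).sub (tendsto_inner_zero_of_bounded hres hCl)).add
      (tendsto_inner_zero_of_bounded hmult hbA)).add
      (tendsto_inner_zero_of_bounded hPinc hbu)).add (tendsto_inner_zero_of_bounded hQinc hbp)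
    rwa [sub_zero, add_zero, add_zero, add_zero, real_inner_comm] at h1
  have hle : ∀ k, F (u (k + 1)) + G (p (k + 1)) ≤ (S k : EReal) := by
    intro k
    rw [← h.gamma_u.coe_toReal (h.ne_top_u k), ← h.gamma_p.coe_toReal (h.ne_top_p k),
      ← EReal.coe_add, EReal.coe_le_coe_iff]
    have h1 := h.gamma_u.add_inner_le (h.sub_u k) hu'
    have h2 := h.gamma_p.add_inner_le (h.sub_p k) hp'
    rw [inner_sub_left, inner_neg_left, ContinuousLinearMap.adjoint_inner_left] at h1 h2
    have h3 : inner ℝ (A u' + B p' - c) (l (k + 1)) -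
        inner ℝ (A (u (k + 1)) + B (p (k + 1)) - c) (l (k + 1)) =
        inner ℝ (l (k + 1)) (A (u' - u (k + 1))) + inner ℝ (l (k + 1)) (B (p' - p (k + 1))) := by
      rw [← inner_sub_left, ← inner_add_right, real_inner_comm, map_sub, map_sub]
      congr 1
      abel
    have h4 : inner ℝ (l k + r • (A (u (k + 1)) + B (p k) - c) - l (k + 1))
        (A (u' - u (k + 1))) =
        inner ℝ (l k + r • (A (u (k + 1)) + B (p k) - c)) (A (u' - u (k + 1))) -
        inner ℝ (l (k + 1)) (A (u' - u (k + 1))) := inner_sub_left _ _ _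
    simp only [S]
    linarith
  refine EReal.add_le_of_forall_lt fun s hs' t ht' => ?_
  refine ge_of_tendsto ((continuous_coe_real_ereal.tendsto _).comp hS) ?_
  filter_upwards [h.gamma_u.eventually_lt_of_weakTendsto hu hs',
    h.gamma_p.eventually_lt_of_weakTendsto hp ht'] with k h1 h2
  exact (add_le_add h1.le h2.le).trans (hle k)

/-! ### Uniqueness of the weak cluster point -/

/-- Replacing the relaxation parameters by their limit does not destroy the convergence of the
Lyapunov function. -/
theorem exists_tendsto_lyapunov_limit (h : IsRelaxedRun F G A B c r ρ σ P Q u p l)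
    (hs : IsSaddlePoint F G A B c us ps ls) :
    ∃ L, Tendsto (fun k => lyapunov B P Q r σ (u (k + 1) - us) (p (k + 1) - ps) (l (k + 1) - ls))
      atTop (𝓝 L) := by
  obtain ⟨L, hL⟩ := h.exists_tendsto_lyapunov hs
  obtain ⟨C, hC⟩ := h.exists_bound_multiplier hs
  have hr := h.r_pos
  refine ⟨L, (tendsto_add_atTop_iff_nat (f := fun k =>
    lyapunov B P Q r σ (u k - us) (p k - ps) (l k - ls)) 1).mpr ?_⟩
  have h1 : Tendsto (fun k => (2 / σ - 2 / ρ k) *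
      (‖(l k - ls) - r • B (p k - ps)‖ ^ 2 / (4 * r))) atTop (𝓝 0) := by
    have h2 : Tendsto (fun k => 2 / σ - 2 / ρ k) atTop (𝓝 0) := by
      have h3 := (tendsto_const_nhds (x := (2 : ℝ))).div h.rho_tendsto h.limit_pos.ne'
      simpa using h3.const_sub (2 / σ)
    refine squeeze_zero_norm (a := fun k => ‖2 / σ - 2 / ρ k‖ * ((C + r * C) ^ 2 / (4 * r)))
      (fun k => ?_) (by simpa using h2.norm.mul_const ((C + r * C) ^ 2 / (4 * r)))
    rw [norm_mul, Real.norm_of_nonneg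
      (show 0 ≤ ‖(l k - ls) - r • B (p k - ps)‖ ^ 2 / (4 * r) by positivity)]
    have h4 : ‖(l k - ls) - r • B (p k - ps)‖ ≤ C + r * C := by
      refine (norm_sub_le _ _).trans ?_
      rw [norm_smul, Real.norm_of_nonneg hr.le]
      have := hC k
      gcongr
      exacts [this.1, this.2]
    gcongr
  have h2 := hL.add h1
  rw [add_zero] at h2
  refine h2.congr fun k => ?_
  simp only [lyapunov, energy]
  ring

/-- Opial's identity: at a weak limit `(ua, pa, la)` the limits of the Lyapunov functions with
respect to `(ua, pa, la)` and to another point differ by the Lyapunov function of the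
difference. -/
theorem lyapunov_limit_sub (h : IsRelaxedRun F G A B c r ρ σ P Q u p l) {U : Filter ℕ} [U.NeBot]
    {ua ub : X} {pa pb : Y} {la lb : Z} (hu : WeakTendsto (fun k => u (k + 1)) U ua)
    (hp : WeakTendsto (fun k => p (k + 1)) U pa) (hl : WeakTendsto (fun k => l (k + 1)) U la)
    {La Lb : ℝ}
    (hLa : Tendsto (fun k =>
      lyapunov B P Q r σ (u (k + 1) - ua) (p (k + 1) - pa) (l (k + 1) - la)) U (𝓝 La))
    (hLb : Tendsto (fun k =>
      lyapunov B P Q r σ (u (k + 1) - ub) (p (k + 1) - pb) (l (k + 1) - lb)) U (𝓝 Lb)) :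
    Lb - La = lyapunov B P Q r σ (ua - ub) (pa - pb) (la - lb) := by
  have hz : ∀ (w : Z) (s : ℝ), Tendsto (fun k =>
      inner ℝ w ((l (k + 1) - la) + s • B (p (k + 1) - pa))) U (𝓝 0) := by
    intro w s
    have h1 := ((weakTendsto_iff_inner.mp hl w).sub_const (inner ℝ w la)).add
      (((weakTendsto_iff_inner.mp (hp.map B) w).sub_const (inner ℝ w (B pa))).const_mul s)
    simpa only [sub_self, mul_zero, add_zero, ← inner_sub_right, ← map_sub,
      ← real_inner_smul_right, ← inner_add_right] using h1
  have hx : ∀ w, Tendsto (fun k => inner ℝ w (u (k + 1) - ua)) U (𝓝 0) := by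
    intro w
    simpa only [sub_self, ← inner_sub_right] using
      (weakTendsto_iff_inner.mp hu w).sub_const (inner ℝ w ua)
  have hy : ∀ w, Tendsto (fun k => inner ℝ w (p (k + 1) - pa)) U (𝓝 0) := by
    intro w
    simpa only [sub_self, ← inner_sub_right] using
      (weakTendsto_iff_inner.mp hp w).sub_const (inner ℝ w pa)
  -- Expand `V (x - b)` around `x - a`: the cross terms tend to zero by weak convergence.
  have h1 := (hLa.add_const (lyapunov B P Q r σ (ua - ub) (pa - pb) (la - lb))).add
    ((((((hz (la - lb - r • B (pa - pb)) (-r)).const_mul (2 / σ - 1)).add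
      (hz (la - lb + r • B (pa - pb)) r)).div_const (2 * r)).add (hx (P (ua - ub)))).add
      (hy (Q (pa - pb))))
  simp only [neg_smul, ← sub_eq_add_neg, mul_zero, add_zero, zero_div] at h1
  have h2 := tendsto_nhds_unique h1 (hLb.congr fun k => by
    rw [← lyapunov_add h.pos_u h.pos_p, sub_add_sub_cancel, sub_add_sub_cancel,
      sub_add_sub_cancel])
  linarith

/-- The limiting Lyapunov function separates saddle points: it controls the multipliers and `B p`,
hence `A u` by feasibility, hence `u` and `p` by strong monotonicity. -/
theorem eq_of_lyapunov_eq_zero (h : IsRelaxedRun F G A B c r ρ σ P Q u p l)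
    {ua ub : X} {pa pb : Y} {la lb : Z} (ha : IsSaddlePoint F G A B c ua pa la)
    (hb : IsSaddlePoint F G A B c ub pb lb)
    (h0 : lyapunov B P Q r σ (ua - ub) (pa - pb) (la - lb) = 0) :
    ua = ub ∧ pa = pb ∧ la = lb := by
  obtain ⟨κ, hκ, hcoer⟩ := h.exists_coercivity
  have h1 := hcoer σ h.limit_pos le_rfl (la - lb) (B (pa - pb))
  have h2 := h.pos_u.inner_nonneg_left (ua - ub)
  have h3 := h.pos_p.inner_nonneg_left (pa - pb)
  rw [lyapunov] at h0
  have h4 : ‖la - lb‖ ^ 2 + ‖B (pa - pb)‖ ^ 2 ≤ 0 := by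
    refine nonpos_of_mul_nonpos_right (a := κ) ?_ hκ
    linarith
  have hl : la - lb = 0 := by
    rw [← norm_eq_zero, ← sq_eq_zero_iff]
    linarith [sq_nonneg ‖la - lb‖, sq_nonneg ‖B (pa - pb)‖]
  have hB : B (pa - pb) = 0 := by
    rw [← norm_eq_zero, ← sq_eq_zero_iff]
    linarith [sq_nonneg ‖la - lb‖, sq_nonneg ‖B (pa - pb)‖]
  have hA : A (ua - ub) = 0 := by
    have h5 := (ha.feasible h.gamma_u h.gamma_p).trans (hb.feasible h.gamma_u h.gamma_p).symm
    rw [map_sub, sub_eq_zero] at hB ⊢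
    rwa [hB, add_left_inj] at h5
  rw [sub_eq_zero] at hl
  subst hl
  refine ⟨?_, ?_, rfl⟩
  · obtain ⟨m, hm, hstrong⟩ := h.strong_u
    have h5 := hstrong _ _ _ (ha.subdiff_left h.gamma_u h.gamma_p) _
      (hb.subdiff_left h.gamma_u h.gamma_p)
    rw [sub_self, inner_zero_left, hA, norm_zero, zero_pow two_ne_zero, mul_zero, add_zero] at h5
    exact sub_eq_zero.mp (norm_eq_zero.mp (pow_eq_zero_iff two_ne_zero |>.mp
      (le_antisymm (nonpos_of_mul_nonpos_right h5 hm) (sq_nonneg _))))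
  · obtain ⟨m, hm, hstrong⟩ := h.strong_p
    have h5 := hstrong _ _ _ (ha.subdiff_right h.gamma_u h.gamma_p) _
      (hb.subdiff_right h.gamma_u h.gamma_p)
    rw [sub_self, inner_zero_left, hB, norm_zero, zero_pow two_ne_zero, mul_zero, add_zero] at h5
    exact sub_eq_zero.mp (norm_eq_zero.mp (pow_eq_zero_iff two_ne_zero |>.mp
      (le_antisymm (nonpos_of_mul_nonpos_right h5 hm) (sq_nonneg _))))

/-- Opial's argument: all weak limits along ultrafilters are saddle points and coincide, so the
iterates converge weakly. -/
theorem exists_weaklyConverges (h : IsRelaxedRun F G A B c r ρ σ P Q u p l)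
    (hs : IsSaddlePoint F G A B c us ps ls) :
    ∃ ua pa la, IsSaddlePoint F G A B c ua pa la ∧
      WeaklyConverges u ua ∧ WeaklyConverges p pa ∧ WeaklyConverges l la := by
  obtain ⟨Cu, hCu⟩ := h.exists_bound_u hs
  obtain ⟨Cp, hCp⟩ := h.exists_bound_p hs
  obtain ⟨Cl, hCl⟩ := h.exists_bound_l hs
  have hlim : ∀ U : Ultrafilter ℕ, (U : Filter ℕ) ≤ atTop → ∃ ua pa la,
      IsSaddlePoint F G A B c ua pa la ∧ WeakTendsto (fun k => u (k + 1)) U ua ∧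
      WeakTendsto (fun k => p (k + 1)) U pa ∧ WeakTendsto (fun k => l (k + 1)) U la := by
    intro U hU
    obtain ⟨ua, hua⟩ := exists_weakTendsto_of_bounded hCu U
    obtain ⟨pa, hpa⟩ := exists_weakTendsto_of_bounded hCp U
    obtain ⟨la, hla⟩ := exists_weakTendsto_of_bounded hCl U
    exact ⟨ua, pa, la, h.isSaddlePoint_of_weakTendsto hs hU hua hpa hla, hua, hpa, hla⟩
  obtain ⟨ua, pa, la, ha, hua, hpa, hla⟩ := hlim (Ultrafilter.of atTop) (Ultrafilter.of_le _)
  obtain ⟨La, hLa⟩ := h.exists_tendsto_lyapunov_limit ha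
  have hall : ∀ U : Ultrafilter ℕ, (U : Filter ℕ) ≤ atTop →
      WeakTendsto (fun k => u (k + 1)) U ua ∧ WeakTendsto (fun k => p (k + 1)) U pa ∧
      WeakTendsto (fun k => l (k + 1)) U la := by
    intro U hU
    obtain ⟨ub, pb, lb, hb, hub, hpb, hlb⟩ := hlim U hU
    obtain ⟨Lb, hLb⟩ := h.exists_tendsto_lyapunov_limit hb
    have h1 := h.lyapunov_limit_sub hua hpa hla (hLa.mono_left (Ultrafilter.of_le _))
      (hLb.mono_left (Ultrafilter.of_le _))
    have h2 := h.lyapunov_limit_sub hub hpb hlb (hLb.mono_left hU) (hLa.mono_left hU)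
    rw [← neg_sub ua, ← neg_sub pa, ← neg_sub la, lyapunov_neg] at h2
    obtain ⟨rfl, rfl, rfl⟩ := h.eq_of_lyapunov_eq_zero ha hb (by linarith)
    exact ⟨hub, hpb, hlb⟩
  refine ⟨ua, pa, la, ha, ?_, ?_, ?_⟩
  · exact (tendsto_add_atTop_iff_nat 1).mp
      ((tendsto_iff_ultrafilter _ _ _).mpr fun U hU => (hall U hU).1)
  · exact (tendsto_add_atTop_iff_nat 1).mp
      ((tendsto_iff_ultrafilter _ _ _).mpr fun U hU => (hall U hU).2.1)
  · exact (tendsto_add_atTop_iff_nat 1).mp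
      ((tendsto_iff_ultrafilter _ _ _).mpr fun U hU => (hall U hU).2.2)

end IsRelaxedRun

end Asymptotics

/-! ### Explicit constants -/

section Constants

variable {X Y Z : Type*}
  [NormedAddCommGroup X] [InnerProductSpace ℝ X] [CompleteSpace X]
  [NormedAddCommGroup Y] [InnerProductSpace ℝ Y] [CompleteSpace Y]
  [NormedAddCommGroup Z] [InnerProductSpace ℝ Z]

theorem lyapunov_eq_of_gram (B : Y →L[ℝ] Z) {P S : X →L[ℝ] X} {Q H : Y →L[ℝ] Y} {r : ℝ} (τ : ℝ)
    (hS : P = r • (S.adjoint ∘L S)) (hH : Q = r • (H.adjoint ∘L H)) (x : X) (y : Y) (z : Z) :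
    lyapunov B P Q r τ x y z = energy r τ z (B y) + r / 2 * ‖S x‖ ^ 2 + r / 2 * ‖H y‖ ^ 2 := by
  rw [lyapunov, hS, hH]
  simp only [smul_apply, ContinuousLinearMap.comp_apply, real_inner_smul_left,
    ContinuousLinearMap.adjoint_inner_left, real_inner_self_eq_norm_sq]
  ring

theorem energy_eq_add_norm_sub_sq {r τ : ℝ} (hr : 0 < r) (hτ : 0 < τ) (z b : Z) :
    energy r τ z b = r * ‖b‖ ^ 2 / 2 + ‖z‖ ^ 2 / (2 * r) +
      (1 - τ) / (2 * τ * r) * ‖z - r • b‖ ^ 2 := by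
  rw [energy_expand hr hτ, norm_sub_sq_real, norm_smul, real_inner_smul_right, mul_pow,
    Real.norm_eq_abs, sq_abs]
  field_simp
  ring

/-- The right-hand side exceeds the energy by `(τ - 1) / (2 τ) * (r ‖b‖² + ‖z‖² / r)`. -/
theorem energy_le_of_one_le {r τ : ℝ} (hr : 0 < r) (hτ : 1 ≤ τ) (z b : Z) :
    energy r τ z b ≤ 1 / τ * (r * ‖b‖ ^ 2 / 2 + ‖z‖ ^ 2 / (2 * r) +
      (τ - 1) / 2 * ‖√r • b + (1 / √r) • z‖ ^ 2) := by
  have hτ0 : 0 < τ := one_pos.trans_le hτ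
  have h1 : ‖√r • b + (1 / √r) • z‖ ^ 2 = r * ‖b‖ ^ 2 + 2 * inner ℝ z b + ‖z‖ ^ 2 / r := by
    have h2 : √r ≠ 0 := (Real.sqrt_pos.mpr hr).ne'
    rw [norm_add_sq_real, norm_smul, norm_smul, real_inner_smul_left, real_inner_smul_right,
      mul_pow, mul_pow, Real.norm_eq_abs, Real.norm_eq_abs, sq_abs, sq_abs, div_pow,
      Real.sq_sqrt hr.le, real_inner_comm]
    field_simp
  rw [energy_expand hr hτ0, h1]
  have h3 : 0 ≤ (τ - 1) / (2 * τ) * (r * ‖b‖ ^ 2 + ‖z‖ ^ 2 / r) := by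
    have : 0 ≤ τ - 1 := sub_nonneg.mpr hτ
    positivity
  rw [← sub_nonneg]
  refine h3.trans_eq ?_
  field_simp
  ring

end Constants

end RelaxedADMM

/-! ### Convergence and ergodic rate -/

open RelaxedADMM in
theorem mainTheorem1 {X Y Z : Type*}
    [NormedAddCommGroup X] [InnerProductSpace ℝ X] [CompleteSpace X]
    [NormedAddCommGroup Y] [InnerProductSpace ℝ Y] [CompleteSpace Y]
    [NormedAddCommGroup Z] [InnerProductSpace ℝ Z] [CompleteSpace Z]
    (F : X → EReal) (G : Y → EReal) (hF : IsGammaZero F) (hG : IsGammaZero G)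
    (A : X →L[ℝ] Z) (B : Y →L[ℝ] Z) (c : Z) (r : ℝ) (hr : 0 < r)
    (hAF : IsStronglyMaximalMonotone (addOp (r • (A.adjoint ∘L A)) (subdiff F)))
    (hBG : IsStronglyMaximalMonotone (addOp (r • (B.adjoint ∘L B)) (subdiff G)))
    (N : X →L[ℝ] X) (M : Y →L[ℝ] Y) (hN : IsSelfAdjoint N) (hM : IsSelfAdjoint M)
    (hNA : (N - r • (A.adjoint ∘L A)).IsPositive)
    (hMB : (M - r • (B.adjoint ∘L B)).IsPositive)
    (ρ : ℕ → ℝ) (hρ : ∀ k, 0 < ρ k ∧ ρ k < 2) (hρmono : Monotone ρ)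
    (hρlim : ∃ ρs : ℝ, ρs < 2 ∧ Tendsto ρ atTop (𝓝 ρs))
    (hsaddle : ∃ u p l, IsSaddlePoint F G A B c u p l)
    (u : ℕ → X) (p : ℕ → Y) (l : ℕ → Z) (hiter : IsRpFADMM F G A B c r ρ N M u p l) :
    ∃ (us : X) (ps : Y) (ls : Z),
      IsSaddlePoint F G A B c us ps ls ∧ IsSolution F G A B c us ps ∧
      -- weak convergence of the iterates
      WeaklyConverges u us ∧ WeaklyConverges p ps ∧ WeaklyConverges l ls ∧
      -- weak convergence of the ergodic averages
      WeaklyConverges (ergodic u) us ∧ WeaklyConverges (ergodic p) ps ∧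
      WeaklyConverges (ergodic l) ls ∧
      -- the partial gap at the ergodic averages is nonnegative
      (∀ k : ℕ, 1 ≤ k →
        0 ≤ partialGap F G A B c us ps ls (ergodic u k) (ergodic p k) (ergodic l k)) ∧
      -- it is of order `1 / k`
      (∃ C : ℝ, ∀ k : ℕ, 1 ≤ k →
        partialGap F G A B c us ps ls (ergodic u k) (ergodic p k) (ergodic l k) ≤
          ((C / (k : ℝ) : ℝ) : EReal)) ∧
      -- explicit constants, with square roots `S` of `(N - rA*A)/r` and `H` of `(M - rB*B)/r`
      (∀ (S : X →L[ℝ] X) (H : Y →L[ℝ] Y),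
        N - r • (A.adjoint ∘L A) = r • (S.adjoint ∘L S) →
        M - r • (B.adjoint ∘L B) = r • (H.adjoint ∘L H) →
        (ρ 1 < 1 → ∀ k : ℕ, 1 ≤ k →
          partialGap F G A B c us ps ls (ergodic u k) (ergodic p k) (ergodic l k) ≤
            ((1 / (k : ℝ) *
              (r * ‖B (p 1) - B ps‖ ^ 2 / 2 + ‖l 1 - ls‖ ^ 2 / (2 * r)
                + (1 - ρ 1) / (2 * ρ 1 * r) *
                    ‖(-(r • B (p 1)) + l 1) - (-(r • B ps) + ls)‖ ^ 2
                + r / 2 * ‖S (u 1 - us)‖ ^ 2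
                + r * (1 / ρ 1 - 1 / 2) * ‖H (p 1 - p 0)‖ ^ 2
                + r / 2 * ‖H (p 1 - ps)‖ ^ 2) : ℝ) : EReal)) ∧
        (1 ≤ ρ 1 → ∀ k : ℕ, 1 ≤ k →
          partialGap F G A B c us ps ls (ergodic u k) (ergodic p k) (ergodic l k) ≤
            ((1 / (k : ℝ) *
              (1 / ρ 1 *
                  (r * ‖B (p 1) - B ps‖ ^ 2 / 2 + ‖l 1 - ls‖ ^ 2 / (2 * r)
                    + (ρ 1 - 1) / 2 *
                        ‖√r • B (p 1 - ps) + (1 / √r) • (l 1 - ls)‖ ^ 2)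
                + r / 2 * ‖S (u 1 - us)‖ ^ 2
                + r * (1 / ρ 1 - 1 / 2) * ‖H (p 1 - p 0)‖ ^ 2
                + r / 2 * ‖H (p 1 - ps)‖ ^ 2) : ℝ) : EReal))) := by
  obtain ⟨σ, hσ2, hσ⟩ := hρlim
  obtain ⟨u₀, p₀, l₀, h₀⟩ := hsaddle
  have hrun := hiter.isRelaxedRun hF hG hr hAF.1 hBG.1 hNA hMB (fun k => (hρ k).1) hρmono hσ hσ2
  obtain ⟨us, ps, ls, hs, hu, hp, hl⟩ := hrun.exists_weaklyConverges h₀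
  have hgap : ∀ {D : ℝ}, lyapunov B (N - r • (A.adjoint ∘L A)) (M - r • (B.adjoint ∘L B)) r (ρ 1)
      (u 1 - us) (p 1 - ps) (l 1 - ls) ≤ D → ∀ k : ℕ, 1 ≤ k →
      partialGap F G A B c us ps ls (ergodic u k) (ergodic p k) (ergodic l k) ≤
        ((1 / (k : ℝ) * D : ℝ) : EReal) := by
    intro D hD k hk
    refine (hrun.partialGap_ergodic_le hs hk).2.trans (EReal.coe_le_coe_iff.mpr ?_)
    gcongr
  refine ⟨us, ps, ls, hs, hs.isSolution hF hG, hu, hp, hl, hu.ergodic, hp.ergodic, hl.ergodic,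
    fun k hk => (hrun.partialGap_ergodic_le hs hk).1, ⟨lyapunov B
    (N - r • (A.adjoint ∘L A)) (M - r • (B.adjoint ∘L B)) r (ρ 1) (u 1 - us) (p 1 - ps)
    (l 1 - ls), fun k hk => ?_⟩, ?_⟩
  · rw [div_eq_mul_one_div, mul_comm]
    exact hgap le_rfl k hk
  intro S H hS hH
  -- The term in `H (p 1 - p 0)` is not needed; it only has to be nonnegative.
  have hslack : 0 ≤ r * (1 / ρ 1 - 1 / 2) * ‖H (p 1 - p 0)‖ ^ 2 := by
    have h1 : 0 ≤ 1 / ρ 1 - 1 / 2 :=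
      sub_nonneg.mpr (one_div_le_one_div_of_le (hρ 1).1 (hρ 1).2.le)
    positivity
  have hlyap := lyapunov_eq_of_gram B (ρ 1) hS hH (u 1 - us) (p 1 - ps) (l 1 - ls)
  have hB : B (p 1 - ps) = B (p 1) - B ps := map_sub _ _ _
  refine ⟨fun _ => hgap ?_, fun h1 => hgap ?_⟩
  · have hv : (-(r • B (p 1)) + l 1) - (-(r • B ps) + ls) =
        (l 1 - ls) - r • (B (p 1) - B ps) := by module
    rw [hlyap, energy_eq_add_norm_sub_sq hr (hρ 1).1, hv, hB]
    linarith
  · have h2 := energy_le_of_one_le hr h1 (l 1 - ls) (B (p 1 - ps))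
    rw [hlyap]
    rw [← hB]
    linarith
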